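/- **Notation.** For $M\in\mathbb R_{>0}^{\mathbb N}$ put $m_k=M_k/k!$, $\mu_0=1$, $\mu_k=M_k/M_{k-1}$ ($k\ge1$). $\mathcal{LC}$ is the set of $M\in\mathbb R_{>0}^{\mathbb N}$ with $1=M_0\le M_1$, $M_j^2\le M_{j-1}M_{j+1}$ for $j\ge1$, and $(M_k)^{1/k}\to\infty$. $M$ has (mg) if $\exists C\ge1\ \forall j,k\in\mathbb N:\ M_{j+k}\le C^{j+k}M_jM_k$; $M$ has $(\beta_3)$ if $\exists Q\in\mathbb N_{>0}:\ \liminf_{p\to\infty}\mu_{Qp}/\mu_p>1$. $M\approx N$ means that $M_p\le C^{p+1}N_p$ and $N_p\le C^{p+1}M_p$ for some $C\ge 1$ and all $p$. The associated function is $\omega_M(t)=\sup_{p}\log(t^pM_0/M_p)$ for $t>0$, $\omega_M(0)=0$. $\mathcal W$ is the set of continuous increasing $\omega:[0,\infty)\to[0,\infty)$ with $\omega|_{[0,1]}=0$, $\omega(t)\to\infty$, $\log t=o(\omega(t))$, $\varphi_\omega(t)=\omega(e^t)$ convex on $\mathbb R$, and $\omega(2t)=O(\omega(t))$ (as $t\to\infty$).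 The condition $(\omega_2)$ means $\omega(t)=O(t)$, $(\omega_5)$ means $\omega(t)=o(t)$ as $t\to\infty$, and $(\omega_6)$ means $\exists H\ge1\ \forall t\ge0:\ 2\omega(t)\le\omega(Ht)+H$. $\sigma\sim\tau$ means $\sigma=O(\tau)$ and $\tau=O(\sigma)$ as $t\to\infty$. Put $\varphi_\omega^*(x)=\sup_{y\ge0}(xy-\varphi_\omega(y))$ and $\Omega^l_j=\exp(\tfrac1l\varphi^*_\omega(lj))$ for $l>0$, $j\in\mathbb N$. For $r,s\in\mathbb N_{>0}$ and $U\subseteq\mathbb R^r$ non-empty and open, $\mathcal E_{\{M\}}(U,\mathbb R^s)$ (resp. $\mathcal E_{(M)}(U,\mathbb R^s)$) is the space of all smooth $f:U\to\mathbb R^s$ such that for every compact $K\subseteq U$ and for some (resp. every) $h>0$ one has $\sup_{k\in\mathbb N,\,x\in K}\|f^{(k)}(x)\|/(h^kM_k)<\infty$, and $\mathcal E_{\{\omega\}}$ (resp. $\mathcal E_{(\omega)}$) is defined in the same way with $\exp(\tfrac1l\varphi_\omega^*(lk))$, $l>0$, in place of $h^kM_k$, $h>0$. The locally convex topology is the projective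 limit over the relatively compact open subsets of $U$ of the inductive (resp. projective) limits over $h$ (resp. $l$) of the corresponding normed spaces. $\mathcal E_{[\cdot]}$ stands for one of $\mathcal E_{\{\cdot\}}$, $\mathcal E_{(\cdot)}$, the same one throughout. **Theorem.** Let $N\in\mathcal{LC}$ have $(\beta_3)$, let $r,s\in\mathbb N_{>0}$ and let $U\subseteq\mathbb R^r$ be non-empty and open. The following are equivalent (in (i) and (iii), equality of sets of functions): (i) there is $\omega\in\mathcal W$ with $\mathcal E_{[\omega]}(U,\mathbb R^s)=\mathcal E_{[N]}(U,\mathbb R^s)$; (ii) $N$ has (mg); (iii) $\mathcal E_{[\omega_N]}(U,\mathbb R^s)=\mathcal E_{[N]}(U,\mathbb R^s)$. Moreover, let $\omega\in\mathcal W$ be any function as in (i), with associated matrix $\{\Omega^l:l>0\}$. Then for each $l>0$: (a) $\omega,\omega_{\Omega^l},\omega_N$ belong to $\mathcal W$ and have $(\omega_6)$; (b) $\omega_{\Omega^l}\sim\omega\sim\omega_N$; (c) $\mathcal E_{[\omega_N]}=\mathcal E_{[N]}=\mathcal E_{[\omega]}=\mathcal E_{[\Omega^l]}$ as locally convex vector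 spaces, on all non-empty open subsets of all $\mathbb R^{r'}$ and with values in all $\mathbb R^{s'}$, $r',s'\in\mathbb N_{>0}$; (d) $N\approx\Omega^l$; (e) $\Omega^l$ has (mg); (f) with $n_p=N_p/p!$: if $\liminf_{p\to\infty}(n_p)^{1/p}>0$, then $\omega,\omega_N,\omega_{\Omega^l}$ have $(\omega_2)$, $\Omega^l$ has $(\beta_3)$, and $\liminf_{k\to\infty}(\Omega^l_k/k!)^{1/k}>0$. If $\lim_{p\to\infty}(n_p)^{1/p}=+\infty$, then $\omega,\omega_N,\omega_{\Omega^l}$ have $(\omega_5)$ and $\lim_{k\to\infty}(\Omega^l_k/k!)^{1/k}=+\infty$. -/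

import Mathlib

open Filter Topology Asymptotics
open scoped ENNReal Nat

namespace Ultradiff

/-! ### Weight sequences -/

/-- The quotients `μ 0 = 1`, `μ k = M k / M (k - 1)` for `k ≥ 1`. -/
noncomputable def quotSeq (M : ℕ → ℝ) : ℕ → ℝ
  | 0 => 1
  | k + 1 => M (k + 1) / M k

/-- The sequence `m k = M k / k!`. -/
noncomputable def smallSeq (M : ℕ → ℝ) (k : ℕ) : ℝ := M k / (k ! : ℝ)

/-- The set `LC`: positive, normalized, log-convex sequences with `(M k)^(1/k) → ∞`. -/
structure IsLC (M : ℕ → ℝ) : Prop where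
  pos : ∀ k, 0 < M k
  zero : M 0 = 1
  one : 1 ≤ M 1
  logConvex : ∀ j, M (j + 1) ^ 2 ≤ M j * M (j + 2)
  root_tendsto : Tendsto (fun k : ℕ => M k ^ (1 / (k : ℝ))) atTop atTop

/-- Moderate growth (mg). -/
def HasMg (M : ℕ → ℝ) : Prop :=
  ∃ C : ℝ, 1 ≤ C ∧ ∀ j k : ℕ, M (j + k) ≤ C ^ (j + k) * M j * M k

/-- Condition (β₃). The lower limit is taken in the extended reals, as it may be infinite. -/
def HasBeta3 (M : ℕ → ℝ) : Prop :=
  ∃ Q : ℕ, 0 < Q ∧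
    1 < liminf (fun p : ℕ => ((quotSeq M (Q * p) / quotSeq M p : ℝ) : EReal)) atTop

/-- `M ≼ N` for weight sequences. -/
def SeqLe (M N : ℕ → ℝ) : Prop :=
  ∃ C₁ C₂ : ℝ, 1 ≤ C₁ ∧ 1 ≤ C₂ ∧ ∀ p : ℕ, M p ≤ C₂ * C₁ ^ p * N p

/-- `M ≈ N` for weight sequences. -/
def SeqEquiv (M N : ℕ → ℝ) : Prop := SeqLe M N ∧ SeqLe N M

/-- `liminf (m p)^(1/p) > 0`, where `m p = M p / p!`. -/
def LiminfPos (M : ℕ → ℝ) : Prop :=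
  0 < liminf (fun p : ℕ => ((smallSeq M p ^ (1 / (p : ℝ)) : ℝ) : EReal)) atTop

/-- `lim (m p)^(1/p) = ∞`, where `m p = M p / p!`. -/
def LimInfinite (M : ℕ → ℝ) : Prop :=
  Tendsto (fun p : ℕ => smallSeq M p ^ (1 / (p : ℝ))) atTop atTop

/-- Condition `(M_H)` for a weight matrix with index set the positive reals. -/
def MatrixH (𝓜 : ℝ → ℕ → ℝ) : Prop := ∀ l : ℝ, 0 < l → LiminfPos (𝓜 l)

/-- The Beurling condition `(M_(C^ω))` for a weight matrix indexed by the positive reals. -/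
def MatrixBeurlingAnalytic (𝓜 : ℝ → ℕ → ℝ) : Prop := ∀ l : ℝ, 0 < l → LimInfinite (𝓜 l)

/-! ### Weight functions

A function `[0,∞) → [0,∞)` is given by a function `ω : ℝ → ℝ`; its values at negative
arguments are never used. -/

/-- (ω₁) -/
def Om1 (ω : ℝ → ℝ) : Prop := (fun t => ω (2 * t)) =O[atTop] ω

/-- (ω₂) -/
def Om2 (ω : ℝ → ℝ) : Prop := ω =O[atTop] (fun t : ℝ => t)

/-- (ω₃) -/
def Om3 (ω : ℝ → ℝ) : Prop := Real.log =o[atTop] ω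

/-- (ω₄) -/
def Om4 (ω : ℝ → ℝ) : Prop := ConvexOn ℝ Set.univ (fun t => ω (Real.exp t))

/-- (ω₅) -/
def Om5 (ω : ℝ → ℝ) : Prop := ω =o[atTop] (fun t : ℝ => t)

/-- (ω₆) -/
def Om6 (ω : ℝ → ℝ) : Prop :=
  ∃ H : ℝ, 1 ≤ H ∧ ∀ t : ℝ, 0 ≤ t → 2 * ω t ≤ ω (H * t) + H

/-- The set `W₀`: weight functions with (ω₃) and (ω₄). -/
structure IsW0 (ω : ℝ → ℝ) : Prop where
  nonneg : ∀ t, 0 ≤ t → 0 ≤ ω t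
  continuousOn : ContinuousOn ω (Set.Ici 0)
  monotoneOn : MonotoneOn ω (Set.Ici 0)
  normalized : ∀ t ∈ Set.Icc (0 : ℝ) 1, ω t = 0
  tendsto : Tendsto ω atTop atTop
  om3 : Om3 ω
  om4 : Om4 ω

/-- The set `W`: elements of `W₀` with (ω₁). -/
structure IsW (ω : ℝ → ℝ) : Prop extends IsW0 ω where
  om1 : Om1 ω

/-- `σ ≼ τ`, that is `τ(t) = O(σ(t))` as `t → ∞`. -/
def FunLe (σ τ : ℝ → ℝ) : Prop := τ =O[atTop] σ

/-- `σ ∼ τ` for weight functions. -/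
def FunEquiv (σ τ : ℝ → ℝ) : Prop := FunLe σ τ ∧ FunLe τ σ

/-- The Young conjugate `φ*(x) = sup {x y - ω(e^y) : y ≥ 0}`; for `ω` in `W₀` and `x ≥ 0` the
supremum is finite. -/
noncomputable def youngConj (ω : ℝ → ℝ) (x : ℝ) : ℝ :=
  sSup ((fun y : ℝ => x * y - ω (Real.exp y)) '' Set.Ici 0)

/-- The matrix associated with `ω`: `Ω^l_j = exp (φ*(l j) / l)`. -/
noncomputable def assocMatrix (ω : ℝ → ℝ) (l : ℝ) (j : ℕ) : ℝ :=
  Real.exp (1 / l * youngConj ω (l * j))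

/-- The associated function `ω_M(t) = sup_p log (t^p M_0 / M_p)` for `t > 0`, `ω_M(0) = 0`; for
`M` in `LC` the supremum is finite. -/
noncomputable def assocFun (M : ℕ → ℝ) (t : ℝ) : ℝ :=
  if t = 0 then 0 else ⨆ p : ℕ, Real.log (t ^ p * M 0 / M p)

/-! ### Classes of ultradifferentiable functions -/

/-- The two types of classes. -/
inductive ClassType
  | roumieu
  | beurling

/-- Euclidean space `ℝ^r`. -/
abbrev Euc (r : ℕ) := EuclideanSpace ℝ (Fin r)

/-- A family of weights `(A h k)`, `k ∈ ℕ`, depending on a parameter `h > 0`. For a weight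
sequence `M` it is `h^k M_k`. -/
noncomputable def seqScale (M : ℕ → ℝ) (h : ℝ) (k : ℕ) : ℝ := h ^ k * M k

/-- The family of weights defining the classes for a weight function `ω`: it is
`exp (φ*(l k) / l)` for the parameter `l > 0`. -/
noncomputable def funScale (ω : ℝ → ℝ) (l : ℝ) (k : ℕ) : ℝ :=
  Real.exp (1 / l * youngConj ω (l * k))

/-- The extended real number `sup {‖f^(k)(x)‖ / a_k : k ∈ ℕ, x ∈ K}`, with the operator norm of
the `k`-linear map `f^(k)(x)`. -/
noncomputable def wnorm {r s : ℕ} (a : ℕ → ℝ) (K : Set (Euc r)) (f : Euc r → Euc s) : ℝ≥0∞ :=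
  ⨆ (k : ℕ) (x ∈ K), ENNReal.ofReal (‖iteratedFDeriv ℝ k f x‖ / a k)

/-- Smooth functions on the open set `U`, represented by their extension by zero. -/
def smoothFun {r : ℕ} (s : ℕ) (U : Set (Euc r)) : Set (Euc r → Euc s) :=
  {f | ContDiffOn ℝ ((⊤ : ℕ∞) : WithTop ℕ∞) f U ∧ ∀ x, x ∉ U → f x = 0}

/-- The class of Roumieu type (for every compact `K ⊆ U` there is a parameter `h > 0` with finite
norm) or of Beurling type (finite norm for every compact `K ⊆ U` and every `h > 0`) on the open
set `U`, with values in `ℝ^s`. -/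
def ultraClass {r : ℕ} (s : ℕ) (U : Set (Euc r)) (A : ℝ → ℕ → ℝ) :
    ClassType → Set (Euc r → Euc s)
  | .roumieu => {f | f ∈ smoothFun s U ∧
      ∀ K : Set (Euc r), IsCompact K → K ⊆ U → ∃ h : ℝ, 0 < h ∧ wnorm (A h) K f < ⊤}
  | .beurling => {f | f ∈ smoothFun s U ∧
      ∀ K : Set (Euc r), IsCompact K → K ⊆ U → ∀ h : ℝ, 0 < h → wnorm (A h) K f < ⊤}

/-- The normed space of smooth functions on the open set `V` with finite norm on `V`. -/
def stepSpace {r : ℕ} (s : ℕ) (V : Set (Euc r)) (a : ℕ → ℝ) : Set (Euc r → Euc s) :=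
  {f | f ∈ smoothFun s V ∧ wnorm a V f < ⊤}

/-- Restriction of functions to `V` (followed by extension by zero), as a linear map. -/
noncomputable def restrictTo {r : ℕ} (s : ℕ) (V : Set (Euc r)) :
    (Euc r → Euc s) →ₗ[ℝ] (Euc r → Euc s) where
  toFun f := V.indicator f
  map_add' f g := Set.indicator_add V f g
  map_smul' c f := Set.indicator_const_smul V c f

/-- `p` restricts to a continuous seminorm on the inductive limit (Roumieu) or the projective limit
(Beurling) of the normed spaces `stepSpace s V (A h)`, `h > 0`. In the Roumieu case this means that
`p` is continuous on each of them; in the Beurling case that `p` is dominated, on their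
intersection, by a multiple of one of the norms. (A seminorm on a linear subspace always extends
to a seminorm on the whole space, so all seminorms on the limit are obtained.) -/
def IsContSeminorm {r s : ℕ} (V : Set (Euc r)) (A : ℝ → ℕ → ℝ)
    (p : Seminorm ℝ (Euc r → Euc s)) : ClassType → Prop
  | .roumieu => ∀ h : ℝ, 0 < h → ∃ C : ℝ,
      ∀ f ∈ stepSpace s V (A h), p f ≤ C * (wnorm (A h) V f).toReal
  | .beurling => ∃ h : ℝ, 0 < h ∧ ∃ C : ℝ,
      ∀ f : Euc r → Euc s, (∀ h' : ℝ, 0 < h' → f ∈ stepSpace s V (A h')) →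
        p f ≤ C * (wnorm (A h) V f).toReal

/-- The locally convex topology of the class on `U`: the projective limit, over the relatively
compact open subsets `V` of `U`, of the inductive (Roumieu) or projective (Beurling) limits over
`h > 0` of the spaces `stepSpace s V (A h)`. It is generated by the balls of the seminorms
`f ↦ p (f restricted to V)`, where `p` is a continuous seminorm on the limit over `h`. -/
@[reducible] def ultraTopology {r : ℕ} (s : ℕ) (U : Set (Euc r)) (A : ℝ → ℕ → ℝ) (ty : ClassType) :
    TopologicalSpace (ultraClass s U A ty) :=
  TopologicalSpace.generateFrom
    {S | ∃ V : Set (Euc r), IsOpen V ∧ IsCompact (closure V) ∧ closure V ⊆ U ∧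
      ∃ p : Seminorm ℝ (Euc r → Euc s), IsContSeminorm V A p ty ∧
      ∃ g ∈ ultraClass s U A ty, ∃ ε : ℝ, 0 < ε ∧
        S = Subtype.val ⁻¹' (p.comp (restrictTo s V)).ball g ε}

/-- The classes on `U` given by two families of weights are equal as locally convex vector spaces:
they consist of the same functions and carry the same topology. (The vector space structure is
always the pointwise one.) -/
def EqLCS {r : ℕ} (s : ℕ) (U : Set (Euc r)) (A B : ℝ → ℕ → ℝ) (ty : ClassType) : Prop :=
  ultraClass s U A ty = ultraClass s U B ty ∧
  ∀ S : Set (Euc r → Euc s),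
    IsOpen[ultraTopology s U A ty] (Subtype.val ⁻¹' S) ↔
      IsOpen[ultraTopology s U B ty] (Subtype.val ⁻¹' S)

/-- Equality of the classes as locally convex vector spaces on all non-empty open subsets of all
`ℝ^r` and with values in all `ℝ^s`, `r, s ≥ 1`. -/
def SameClass (ty : ClassType) (A B : ℝ → ℕ → ℝ) : Prop :=
  ∀ r s : ℕ, 0 < r → 0 < s → ∀ U : Set (Euc r), IsOpen U → U.Nonempty → EqLCS s U A B ty

end Ultradiff

open Ultradiff

namespace Ultradiff

/-! ### Log-convex sequences -/

section Sequences

variable {M N : ℕ → ℝ}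

/-! Up to the factor `l`, `log (assocMatrix ω l j)` is a Legendre transform: the supremum over `y ≥
0` of `j * y - ω (exp y) / l`. Halving `ω / l` gives the two relations between the parameters `l`
and `2l` on which everything rests: `Ω^l_{j+k} ≤ Ω^{2l}_j Ω^{2l}_k` and `(Ω^{2l}_j)² ≤ Ω^l_{2j}`
(`assocMatrix_add_le`, `assocMatrix_sq_le`).

If the classes of `ω` and `N` agree, lacunary trigonometric series with extremal derivatives at one
point (`exists_le_of_forall_smooth`) force `N ≼ Ω^l` and `Ω^{2l} ≼ N` for some `l`. The first
relation then yields (mg) for `N`. The second, combined with (mg), spreads `N ≈ Ω^l` to all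
parameters by doubling and halving (`seqEquiv_assocMatrix`).

Conversely, the matrix of `ω_N` at parameter `1` is `N` itself, so (mg) makes `N` equivalent to
every member of that matrix. (β₃) gives (ω₁) for `ω_N`, and (ω₁) absorbs geometric factors `h^k`
into a change of `l`. The two families of weights therefore dominate each other, which identifies
both the functions and the topologies.

The remaining assertions follow from `N ≈ Ω^l` and from Legendre duality, which gives `ω_{Ω^l} ∼ ω`.
-/

lemma ratio_monotone (hpos : ∀ k, 0 < M k) (hlc : ∀ j, M (j + 1) ^ 2 ≤ M j * M (j + 2)) :
    Monotone (fun k => M (k + 1) / M k) := by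
  refine monotone_nat_of_le_succ fun k => ?_
  rw [div_le_div_iff₀ (hpos _) (hpos _)]
  nlinarith [hlc k]

/-- The geometric progression through `M j` with ratio `M (j + 1) / M j` supports a log-convex
sequence from below. -/
lemma logConvex_support (hpos : ∀ k, 0 < M k) (hlc : ∀ j, M (j + 1) ^ 2 ≤ M j * M (j + 2))
    (j p : ℕ) : (M (j + 1) / M j) ^ p * M j ≤ (M (j + 1) / M j) ^ j * M p := by
  have hmono := ratio_monotone hpos hlc
  have hq : ∀ k, 0 < M (k + 1) / M k := fun k => div_pos (hpos _) (hpos _)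
  have hstep : ∀ k, M (k + 1) = M (k + 1) / M k * M k := fun k =>
    (div_mul_cancel₀ _ (hpos k).ne').symm
  rcases le_total j p with h | h
  · obtain ⟨d, rfl⟩ := Nat.exists_eq_add_of_le h
    have key : ∀ d, (M (j + 1) / M j) ^ d * M j ≤ M (j + d) := by
      intro d
      induction d with
      | zero => simp
      | succ d ih =>
        calc (M (j + 1) / M j) ^ (d + 1) * M j
            = M (j + 1) / M j * ((M (j + 1) / M j) ^ d * M j) := by ring
          _ ≤ M (j + d + 1) / M (j + d) * M (j + d) :=
            mul_le_mul (hmono (Nat.le_add_right j d)) ih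
              (mul_nonneg (pow_nonneg (hq j).le _) (hpos j).le) (hq _).le
          _ = M (j + (d + 1)) := (hstep (j + d)).symm
    rw [pow_add, mul_assoc]
    exact mul_le_mul_of_nonneg_left (key d) (pow_nonneg (hq j).le _)
  · obtain ⟨d, rfl⟩ := Nat.exists_eq_add_of_le h
    have key : ∀ d, M (p + d) ≤ (M (p + d + 1) / M (p + d)) ^ d * M p := by
      intro d
      induction d with
      | zero => simp
      | succ d ih =>
        have h1 := hmono (Nat.le_succ (p + d))
        calc M (p + (d + 1)) = M (p + d + 1) / M (p + d) * M (p + d) := hstep (p + d)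
          _ ≤ M (p + d + 1) / M (p + d) * ((M (p + d + 1) / M (p + d)) ^ d * M p) :=
            mul_le_mul_of_nonneg_left ih (hq _).le
          _ = (M (p + d + 1) / M (p + d)) ^ (d + 1) * M p := by ring
          _ ≤ _ := mul_le_mul_of_nonneg_right (pow_le_pow_left₀ (hq _).le h1 _) (hpos p).le
    rw [pow_add _ p d, mul_assoc]
    exact mul_le_mul_of_nonneg_left (key d) (pow_nonneg (hq _).le _)

lemma IsLC.monotone_quotSeq (hM : IsLC M) : Monotone (quotSeq M) := by
  refine monotone_nat_of_le_succ fun k => ?_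
  cases k with
  | zero => simpa [quotSeq, hM.zero] using hM.one
  | succ k => exact ratio_monotone hM.pos hM.logConvex (Nat.le_succ k)

lemma IsLC.one_le_quotSeq (hM : IsLC M) (k : ℕ) : 1 ≤ quotSeq M k :=
  hM.monotone_quotSeq (Nat.zero_le k)

lemma IsLC.quotSeq_pos (hM : IsLC M) (k : ℕ) : 0 < quotSeq M k :=
  zero_lt_one.trans_le (hM.one_le_quotSeq k)

lemma IsLC.succ_eq (hM : IsLC M) (k : ℕ) : M (k + 1) = quotSeq M (k + 1) * M k :=
  (div_mul_cancel₀ _ (hM.pos k).ne').symm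

lemma IsLC.monotone (hM : IsLC M) : Monotone M := by
  refine monotone_nat_of_le_succ fun k => ?_
  rw [hM.succ_eq k]
  exact le_mul_of_one_le_left (hM.pos k).le (hM.one_le_quotSeq _)

lemma IsLC.one_le (hM : IsLC M) (k : ℕ) : 1 ≤ M k := hM.zero ▸ hM.monotone (Nat.zero_le k)

lemma IsLC.log_eq_sum (hM : IsLC M) (p : ℕ) :
    Real.log (M p) = ∑ j ∈ Finset.range p, Real.log (quotSeq M (j + 1)) := by
  induction p with
  | zero => simp [hM.zero]
  | succ p ih =>
    rw [Finset.sum_range_succ, ← ih, hM.succ_eq, Real.log_mul (hM.quotSeq_pos _).ne' (hM.pos _).ne',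
      add_comm]

lemma IsLC.le_quotSeq_pow (hM : IsLC M) (p : ℕ) : M p ≤ quotSeq M p ^ p := by
  induction p with
  | zero => simp [hM.zero]
  | succ p ih =>
    rw [hM.succ_eq, pow_succ']
    refine mul_le_mul_of_nonneg_left (ih.trans ?_) (hM.quotSeq_pos _).le
    exact pow_le_pow_left₀ (hM.quotSeq_pos _).le (hM.monotone_quotSeq (Nat.le_succ p)) _

lemma IsLC.quotSeq_pow_mul_le (hM : IsLC M) (p d : ℕ) : quotSeq M p ^ d * M p ≤ M (p + d) := by
  induction d with
  | zero => simp
  | succ d ih =>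
    rw [← add_assoc, hM.succ_eq, pow_succ', mul_assoc]
    exact mul_le_mul (hM.monotone_quotSeq (by omega)) ih
      (mul_nonneg (pow_nonneg (hM.quotSeq_pos _).le _) (hM.pos _).le) (hM.quotSeq_pos _).le

lemma SeqLe.trans {L : ℕ → ℝ} (h₁ : SeqLe M N) (h₂ : SeqLe N L) : SeqLe M L := by
  obtain ⟨a, b, ha, hb, h⟩ := h₁
  obtain ⟨c, d, hc, hd, h'⟩ := h₂
  refine ⟨a * c, b * d, one_le_mul_of_one_le_of_one_le ha hc,
    one_le_mul_of_one_le_of_one_le hb hd, fun p => (h p).trans ?_⟩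
  calc b * a ^ p * N p ≤ b * a ^ p * (d * c ^ p * L p) :=
        mul_le_mul_of_nonneg_left (h' p) (by positivity)
    _ = _ := by rw [mul_pow]; ring

/-- Moderate growth bounds the quotients of a smaller sequence by those of a larger one. -/
lemma quotSeq_le_of_seqLe (hM : IsLC M) (hN : IsLC N) (hMmg : HasMg M) (h : SeqLe M N) :
    ∃ C : ℝ, 1 ≤ C ∧ ∀ p, quotSeq M p ≤ C * quotSeq N p := by
  obtain ⟨A, hA, hmg⟩ := hMmg
  obtain ⟨B, K, hB, hK, hle⟩ := h
  refine ⟨A ^ 2 * K * B, one_le_mul_of_one_le_of_one_le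
    (one_le_mul_of_one_le_of_one_le (one_le_pow₀ hA) hK) hB, fun p => ?_⟩
  rcases Nat.eq_zero_or_pos p with rfl | hp
  · simpa [quotSeq] using one_le_mul_of_one_le_of_one_le
      (one_le_mul_of_one_le_of_one_le (one_le_pow₀ hA (n := 2)) hK) hB
  -- `μ_p^p M_p ≤ M_{2p} ≤ A^{2p} M_p²`. As `N p ≤ quotSeq N p ^ p`, the claim follows by taking
  -- `p`-th roots.
  have h1 : quotSeq M p ^ p ≤ (A ^ 2) ^ p * M p := by
    have h2 := (hM.quotSeq_pow_mul_le p p).trans (hmg p p)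
    refine le_of_mul_le_mul_right (h2.trans (le_of_eq ?_)) (hM.pos p)
    rw [← pow_mul, two_mul]
  refine le_of_pow_le_pow_left₀ hp.ne' (by have := hN.quotSeq_pos p; positivity) ?_
  calc quotSeq M p ^ p ≤ (A ^ 2) ^ p * M p := h1
    _ ≤ (A ^ 2) ^ p * (K ^ p * B ^ p * quotSeq N p ^ p) := by
      refine mul_le_mul_of_nonneg_left ((hle p).trans ?_) (by positivity)
      have := hN.le_quotSeq_pow p
      have := le_self_pow₀ hK hp.ne'
      have := hN.pos p
      gcongr
    _ = _ := by ring

/-- The constant `K` can be moved into the base: `K ≤ K ^ n` for `n ≥ 1`, and at `j = k = 0` both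
sides are explicit. -/
lemma IsLC.hasMg_of_le (hN : IsLC N) {K B : ℝ} (hK : 1 ≤ K) (hB : 1 ≤ B)
    (h : ∀ j k, N (j + k) ≤ K * B ^ (j + k) * N j * N k) : HasMg N := by
  refine ⟨K * B, one_le_mul_of_one_le_of_one_le hK hB, fun j k => ?_⟩
  rcases Nat.eq_zero_or_pos (j + k) with h0 | h0
  · obtain ⟨rfl, rfl⟩ : j = 0 ∧ k = 0 := by omega
    simp [hN.zero]
  · refine (h j k).trans ?_
    have hj := hN.pos j
    have hk := hN.pos k
    rw [mul_pow]
    gcongr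
    exact le_self_pow₀ hK h0.ne'

lemma HasMg.of_equiv (hM : IsLC M) (hN : IsLC N) (hmg : HasMg M) (h : SeqEquiv M N) :
    HasMg N := by
  obtain ⟨A, hA, hmg⟩ := hmg
  obtain ⟨⟨B, K, hB, hK, h₁⟩, ⟨B', K', hB', hK', h₂⟩⟩ := h
  refine hN.hasMg_of_le (K := K' * K * K) (B := B' * A * B) (one_le_mul_of_one_le_of_one_le
    (one_le_mul_of_one_le_of_one_le hK' hK) hK) (one_le_mul_of_one_le_of_one_le
    (one_le_mul_of_one_le_of_one_le hB' hA) hB) fun j k => ?_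
  have hj := hN.pos j
  have hk := hN.pos k
  have hk' := hM.pos k
  calc N (j + k) ≤ K' * B' ^ (j + k) * M (j + k) := h₂ _
    _ ≤ K' * B' ^ (j + k) * (A ^ (j + k) * (K * B ^ j * N j) * (K * B ^ k * N k)) := by
      refine mul_le_mul_of_nonneg_left ((hmg j k).trans ?_) (by positivity)
      gcongr
      · exact h₁ j
      · exact h₁ k
    _ = _ := by rw [mul_pow, mul_pow, pow_add B]; ring

/-- The quotients along a multiple of the index grow by any prescribed factor under (β₃). -/
lemma HasBeta3.exists_mul_le (hM : IsLC M) (h : HasBeta3 M) (b : ℝ) :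
    ∃ R : ℕ, 0 < R ∧ ∃ p₀ : ℕ, ∀ p, p₀ ≤ p → b * quotSeq M p ≤ quotSeq M (R * p) := by
  obtain ⟨Q, hQ, hlim⟩ := h
  obtain ⟨c, hc1, hc2⟩ := EReal.lt_iff_exists_real_btwn.1 hlim
  have hc : 1 < c := by exact_mod_cast hc1
  obtain ⟨p₀, hp₀⟩ := eventually_atTop.1 (eventually_lt_of_lt_liminf hc2)
  have hstep : ∀ p, p₀ ≤ p → c * quotSeq M p ≤ quotSeq M (Q * p) := fun p hp =>
    ((lt_div_iff₀ (hM.quotSeq_pos p)).1 (EReal.coe_lt_coe_iff.1 (hp₀ p hp))).le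
  have hpow : ∀ n p, p₀ ≤ p → c ^ n * quotSeq M p ≤ quotSeq M (Q ^ n * p) := by
    intro n p hp
    induction n with
    | zero => simp
    | succ n ih =>
      have h1 := hstep (Q ^ n * p) (hp.trans (Nat.le_mul_of_pos_left p (pow_pos hQ n)))
      rw [pow_succ', pow_succ', mul_assoc, mul_assoc]
      exact (mul_le_mul_of_nonneg_left ih (by linarith)).trans h1
  obtain ⟨n, hn⟩ := pow_unbounded_of_one_lt b hc
  exact ⟨Q ^ n, pow_pos hQ n, p₀, fun p hp =>
    (mul_le_mul_of_nonneg_right hn.le (hM.quotSeq_pos p).le).trans (hpow n p hp)⟩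

/-- In the presence of moderate growth, (β₃) is invariant under equivalence. -/
lemma HasBeta3.of_equiv (hM : IsLC M) (hN : IsLC N) (hMmg : HasMg M) (hNmg : HasMg N)
    (h : SeqEquiv M N) (hβ : HasBeta3 M) : HasBeta3 N := by
  obtain ⟨C, hC, h₁⟩ := quotSeq_le_of_seqLe hM hN hMmg h.1
  obtain ⟨D, hD, h₂⟩ := quotSeq_le_of_seqLe hN hM hNmg h.2
  -- Passing between the two quotient sequences costs `C * D`; the extra `2` leaves a lower limit of
  -- at least `2`.
  obtain ⟨R, hR, p₀, hp⟩ := hβ.exists_mul_le hM (2 * (C * D))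
  refine ⟨R, hR, lt_of_lt_of_le (b := ((2 : ℝ) : EReal)) (by norm_cast) ?_⟩
  refine le_liminf_of_le (by isBoundedDefault) (eventually_atTop.2 ⟨p₀, fun p hpp => ?_⟩)
  rw [EReal.coe_le_coe_iff, le_div_iff₀ (hN.quotSeq_pos p)]
  have hCD : 0 < C * D := by positivity
  have h3 : C * (2 * D * quotSeq M p) ≤ C * quotSeq N (R * p) := by
    calc _ = 2 * (C * D) * quotSeq M p := by ring
      _ ≤ quotSeq M (R * p) := hp p hpp
      _ ≤ _ := h₁ _
  have h4 := le_of_mul_le_mul_left h3 (by positivity)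
  linarith [h₂ p]

end Sequences

/-! ### The associated function -/

section AssocFun

variable {M N : ℕ → ℝ}

lemma IsLC.log_pow_mul_div (hM : IsLC M) {t : ℝ} (ht : 0 < t) (p : ℕ) :
    Real.log (t ^ p * M 0 / M p) = p * Real.log t - Real.log (M p) := by
  rw [hM.zero, mul_one, Real.log_div (pow_pos ht p).ne' (hM.pos p).ne', Real.log_pow]

/-- Once `M p ^ (1 / p) ≥ t`, the `p`-th term is at most `0`. -/
lemma IsLC.bddAbove_assocFun (hM : IsLC M) {t : ℝ} (ht : 0 < t) :
    BddAbove (Set.range fun p : ℕ => Real.log (t ^ p * M 0 / M p)) := by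
  refine IsBoundedUnder.bddAbove_range ⟨0, eventually_map.2 ?_⟩
  filter_upwards [hM.root_tendsto.eventually_ge_atTop t, eventually_gt_atTop 0] with p hp hp0
  rw [hM.log_pow_mul_div ht]
  have h1 := Real.log_le_log ht hp
  rw [Real.log_rpow (hM.pos p), one_div, inv_mul_eq_div,
    le_div_iff₀ (by exact_mod_cast hp0)] at h1
  linarith

lemma IsLC.le_assocFun (hM : IsLC M) {t : ℝ} (ht : 0 < t) (p : ℕ) :
    p * Real.log t - Real.log (M p) ≤ assocFun M t := by
  rw [assocFun, if_neg ht.ne', ← hM.log_pow_mul_div ht]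
  exact le_ciSup (hM.bddAbove_assocFun ht) p

lemma IsLC.assocFun_le (hM : IsLC M) {t b : ℝ} (ht : 0 < t)
    (h : ∀ p : ℕ, p * Real.log t - Real.log (M p) ≤ b) : assocFun M t ≤ b := by
  rw [assocFun, if_neg ht.ne']
  exact ciSup_le fun p => (hM.log_pow_mul_div ht p).trans_le (h p)

lemma IsLC.assocFun_nonneg (hM : IsLC M) {t : ℝ} (ht : 0 ≤ t) : 0 ≤ assocFun M t := by
  rcases ht.eq_or_lt with rfl | ht
  · simp [assocFun]
  · simpa [hM.zero] using hM.le_assocFun ht 0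

lemma IsLC.assocFun_eq_zero (hM : IsLC M) {t : ℝ} (ht : t ∈ Set.Icc (0 : ℝ) 1) :
    assocFun M t = 0 := by
  refine le_antisymm ?_ (hM.assocFun_nonneg ht.1)
  rcases ht.1.eq_or_lt with rfl | h0
  · simp [assocFun]
  · refine hM.assocFun_le h0 fun p => ?_
    have h1 := Real.log_nonneg (hM.one_le p)
    have h2 := mul_nonneg (Nat.cast_nonneg (α := ℝ) p) (neg_nonneg.2 (Real.log_nonpos ht.1 ht.2))
    linarith

lemma IsLC.monotoneOn_assocFun (hM : IsLC M) : MonotoneOn (assocFun M) (Set.Ici 0) := by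
  intro a ha b hb hab
  rcases (show (0 : ℝ) ≤ a from ha).eq_or_lt with rfl | h0
  · rw [hM.assocFun_eq_zero ⟨le_rfl, zero_le_one⟩]
    exact hM.assocFun_nonneg hb
  · refine hM.assocFun_le h0 fun p => le_trans ?_ (hM.le_assocFun (h0.trans_le hab) p)
    gcongr

lemma IsLC.om4_assocFun (hM : IsLC M) : Om4 (assocFun M) := by
  refine ⟨convex_univ, fun x _ y _ a b ha hb hab => ?_⟩
  refine hM.assocFun_le (Real.exp_pos _) fun p => ?_
  have hx := mul_le_mul_of_nonneg_left (hM.le_assocFun (Real.exp_pos x) p) ha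
  have hy := mul_le_mul_of_nonneg_left (hM.le_assocFun (Real.exp_pos y) p) hb
  rw [Real.log_exp] at hx hy ⊢
  simp only [smul_eq_mul]
  have : Real.log (M p) = (a + b) * Real.log (M p) := by rw [hab, one_mul]
  rw [this]
  linarith

/-- Away from `0` continuity comes from convexity in `log t`; near `0` the function vanishes. -/
lemma IsLC.continuousOn_assocFun (hM : IsLC M) : ContinuousOn (assocFun M) (Set.Ici 0) := by
  have hc : Continuous fun t => assocFun M (Real.exp t) :=
    continuousOn_univ.1 (hM.om4_assocFun.continuousOn isOpen_univ)
  intro t ht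
  rcases (show (0 : ℝ) ≤ t from ht).eq_or_lt with rfl | h0
  · have h1 : assocFun M =ᶠ[𝓝[Set.Ici 0] 0] fun _ => 0 := by
      filter_upwards [self_mem_nhdsWithin,
        nhdsWithin_le_nhds (Iio_mem_nhds (zero_lt_one (α := ℝ)))] with x hx hx1
      exact hM.assocFun_eq_zero ⟨hx, le_of_lt hx1⟩
    exact (continuousWithinAt_const (b := (0 : ℝ))).congr_of_eventuallyEq h1
      (hM.assocFun_eq_zero ⟨le_rfl, zero_le_one⟩)
  · have h1 : ContinuousAt (fun t => assocFun M (Real.exp (Real.log t))) t :=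
      hc.continuousAt.comp (Real.continuousAt_log h0.ne')
    refine (h1.congr ?_).continuousWithinAt
    filter_upwards [lt_mem_nhds h0] with x hx
    rw [Real.exp_log hx]

lemma IsLC.tendsto_assocFun (hM : IsLC M) : Tendsto (assocFun M) atTop atTop := by
  refine tendsto_atTop_mono' _ ?_
    (tendsto_atTop_add_const_right _ (-Real.log (M 1)) Real.tendsto_log_atTop)
  filter_upwards [eventually_gt_atTop 0] with t ht
  simpa [sub_eq_add_neg] using hM.le_assocFun ht 1

lemma IsLC.om3_assocFun (hM : IsLC M) : Om3 (assocFun M) := by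
  refine isLittleO_iff.2 fun c hc => ?_
  -- The single term of index `p` suffices: `c * p ≥ 2` gives `2 log t`, one half of which pays for
  -- `c * log (M p)`.
  obtain ⟨p, hp⟩ := exists_nat_ge (2 / c)
  filter_upwards [eventually_gt_atTop 1,
    Real.tendsto_log_atTop.eventually_ge_atTop (c * Real.log (M p))] with t ht hlog
  have h0 := Real.log_pos ht
  have h1 := hM.le_assocFun (zero_lt_one.trans ht) p
  rw [Real.norm_of_nonneg h0.le, Real.norm_of_nonneg (hM.assocFun_nonneg (by linarith))]
  have h2 : 2 ≤ c * p := by rwa [div_le_iff₀' hc] at hp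
  nlinarith

lemma IsLC.isW0_assocFun (hM : IsLC M) : IsW0 (assocFun M) where
  nonneg _ := hM.assocFun_nonneg
  continuousOn := hM.continuousOn_assocFun
  monotoneOn := hM.monotoneOn_assocFun
  normalized _ := hM.assocFun_eq_zero
  tendsto := hM.tendsto_assocFun
  om3 := hM.om3_assocFun
  om4 := hM.om4_assocFun

/-- Moderate growth gives (ω₆) for the associated function. -/
lemma IsLC.om6_assocFun (hM : IsLC M) (hmg : HasMg M) : Om6 (assocFun M) := by
  obtain ⟨C, hC, hmg⟩ := hmg
  refine ⟨C, hC, fun t ht => ?_⟩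
  rcases ht.eq_or_lt with rfl | h0
  · simp only [hM.assocFun_eq_zero (t := 0) ⟨le_rfl, zero_le_one⟩, mul_zero]
    linarith
  have hCt : 0 < C * t := by positivity
  -- By (mg) the product of `t^p / M_p` and `t^q / M_q` is at most `(Ct)^{p+q} / M_{p+q}`. The
  -- suprema over `q` and then over `p` are taken below.
  have key : ∀ p q : ℕ, (p * Real.log t - Real.log (M p)) + (q * Real.log t - Real.log (M q)) ≤
      assocFun M (C * t) := by
    intro p q
    refine le_trans ?_ (hM.le_assocFun hCt (p + q))
    have h1 := Real.log_le_log (hM.pos _) (hmg p q)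
    rw [Real.log_mul (mul_pos (pow_pos (by linarith) _) (hM.pos _)).ne' (hM.pos _).ne',
      Real.log_mul (pow_pos (by linarith) _).ne' (hM.pos _).ne', Real.log_pow] at h1
    rw [Real.log_mul (by linarith) h0.ne']
    push_cast at h1 ⊢
    linarith
  have h2 : ∀ p : ℕ, assocFun M t ≤ assocFun M (C * t) - (p * Real.log t - Real.log (M p)) :=
    fun p => hM.assocFun_le h0 fun q => by linarith [key p q]
  have h3 : assocFun M t ≤ assocFun M (C * t) - assocFun M t :=
    hM.assocFun_le h0 fun p => by linarith [h2 p]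
  linarith

/-- `i / R` is division in `ℕ`, so each `j < p` is hit by exactly `R` indices `i`. -/
lemma sum_range_mul_div (f : ℕ → ℝ) {R : ℕ} (hR : 0 < R) (p : ℕ) :
    ∑ i ∈ Finset.range (R * p), f (i / R) = R * ∑ j ∈ Finset.range p, f j := by
  induction p with
  | zero => simp
  | succ p ih =>
    rw [Nat.mul_succ, Finset.sum_range_add, ih, Finset.sum_range_succ, mul_add]
    congr 1
    rw [Finset.sum_congr rfl fun k hk => by
      rw [Nat.mul_add_div hR, Nat.div_eq_of_lt (Finset.mem_range.1 hk), add_zero]]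
    simp

/-- The quotients increase, so the positive parts stop contributing once `quotSeq M` exceeds `t`; up
to there the sum telescopes to `p log t - log (M p)`. -/
lemma IsLC.sum_max_le_assocFun (hM : IsLC M) {t : ℝ} (ht : 0 < t) (p : ℕ) :
    ∑ j ∈ Finset.range p, max 0 (Real.log t - Real.log (quotSeq M (j + 1))) ≤ assocFun M t := by
  induction p with
  | zero => simpa using hM.assocFun_nonneg ht.le
  | succ p ih =>
    rcases le_total (quotSeq M (p + 1)) t with h | h
    · have h1 : ∀ j ∈ Finset.range (p + 1),
          max 0 (Real.log t - Real.log (quotSeq M (j + 1))) =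
            Real.log t - Real.log (quotSeq M (j + 1)) := by
        intro j hj
        refine max_eq_right (sub_nonneg.2 (Real.log_le_log (hM.quotSeq_pos _) (le_trans ?_ h)))
        exact hM.monotone_quotSeq (by have := Finset.mem_range.1 hj; omega)
      rw [Finset.sum_congr rfl h1, Finset.sum_sub_distrib, ← hM.log_eq_sum]
      simpa using hM.le_assocFun ht (p + 1)
    · rw [Finset.sum_range_succ, max_eq_left (sub_nonpos.2 (Real.log_le_log ht h)), add_zero]
      exact ih

/-- (β₃) gives (ω₁) for the associated function. -/
lemma IsLC.om1_assocFun (hM : IsLC M) (hβ : HasBeta3 M) : Om1 (assocFun M) := by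
  obtain ⟨R, hR, p₀, hβ⟩ := hβ.exists_mul_le hM 2
  have hl2 : 0 ≤ Real.log 2 := Real.log_nonneg one_le_two
  have key : ∀ t : ℝ, 1 ≤ t →
      assocFun M (2 * t) ≤ (R * p₀ : ℕ) * Real.log 2 + R * (Real.log t + assocFun M t) := by
    intro t ht
    have ht0 : 0 < t := by linarith
    set f : ℕ → ℝ := fun j => max 0 (Real.log t - Real.log (quotSeq M j)) with hf
    have hf0 : ∀ j, 0 ≤ f j := fun j => le_max_left _ _
    have hsum : ∀ p, ∑ i ∈ Finset.range p, f (i / R) ≤ R * (Real.log t + assocFun M t) := by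
      intro p
      calc ∑ i ∈ Finset.range p, f (i / R) ≤ ∑ i ∈ Finset.range (R * (p + 1)), f (i / R) :=
            Finset.sum_le_sum_of_subset_of_nonneg
              (Finset.range_subset_range.2 (by nlinarith)) fun i _ _ => hf0 _
        _ = R * ∑ j ∈ Finset.range (p + 1), f j := sum_range_mul_div f hR _
        _ ≤ _ := by
          refine mul_le_mul_of_nonneg_left ?_ (Nat.cast_nonneg _)
          -- The index `j = 0` contributes `log t`, because `quotSeq M 0 = 1`.
          rw [Finset.sum_range_succ', add_comm]
          refine add_le_add ?_ (hM.sum_max_le_assocFun ht0 p)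
          simp [hf, quotSeq, Real.log_nonneg ht]
    refine hM.assocFun_le (by linarith) fun p => le_trans ?_ (add_le_add_right (hsum p) _)
    -- The left side is a sum of `log (2t / μ_{i+1})` over `i < p`. For `i ≥ R * p₀`, (β₃) gives
    -- `μ_{i+1} ≥ 2 μ_{i/R}`, which cancels the `2`; each earlier index costs one extra `log 2`.
    have hind : ∀ p : ℕ, (p : ℝ) * Real.log (2 * t) - Real.log (M p) ≤
        (min p (R * p₀) : ℕ) * Real.log 2 + ∑ i ∈ Finset.range p, f (i / R) := by
      intro p
      induction p with
      | zero => simp [hM.zero]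
      | succ p ih =>
        rw [Finset.sum_range_succ, hM.succ_eq,
          Real.log_mul (hM.quotSeq_pos _).ne' (hM.pos _).ne']
        have hlog : Real.log (2 * t) = Real.log 2 + Real.log t :=
          Real.log_mul two_ne_zero ht0.ne'
        have hfp : Real.log t - Real.log (quotSeq M (p / R)) ≤ f (p / R) := le_max_right _ _
        push_cast
        rcases lt_or_ge p (R * p₀) with h | h
        · rw [min_eq_left h.le] at ih
          have hmin : min ((p : ℝ) + 1) (R * p₀) = p + 1 := min_eq_left (by exact_mod_cast h)
          rw [hmin]
          have := Real.log_le_log (hM.quotSeq_pos _)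
            (hM.monotone_quotSeq ((Nat.div_le_self p R).trans (Nat.le_succ p)))
          linarith
        · rw [min_eq_right h] at ih
          have hmin : min ((p : ℝ) + 1) (R * p₀) = R * p₀ :=
            min_eq_right (by exact_mod_cast h.trans (Nat.le_succ p))
          rw [hmin]
          have h1 := hβ (p / R) ((Nat.le_div_iff_mul_le hR).2 (by rwa [mul_comm]))
          have h2 := h1.trans (hM.monotone_quotSeq ((Nat.mul_div_le p R).trans (Nat.le_succ p)))
          have h3 := Real.log_le_log (mul_pos two_pos (hM.quotSeq_pos _)) h2
          rw [Real.log_mul two_ne_zero (hM.quotSeq_pos _).ne'] at h3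
          push_cast at ih
          linarith
    refine (hind p).trans (add_le_add_left (mul_le_mul_of_nonneg_right ?_ hl2) _)
    exact_mod_cast min_le_right _ _
  -- One multiple of `assocFun M t` pays for the constant, `R` for `R * log t` by (ω₃), and `R` are
  -- already in `key`.
  refine IsBigO.of_bound (1 + 2 * R) ?_
  have h3 := hM.om3_assocFun.bound (zero_lt_one (α := ℝ))
  filter_upwards [h3, eventually_ge_atTop 1,
    hM.tendsto_assocFun.eventually_ge_atTop ((R * p₀ : ℕ) * Real.log 2)] with t h3 ht hbig
  rw [Real.norm_of_nonneg (hM.assocFun_nonneg (by linarith)),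
    Real.norm_of_nonneg (hM.assocFun_nonneg (by linarith))]
  rw [Real.norm_of_nonneg (Real.log_nonneg ht),
    Real.norm_of_nonneg (hM.assocFun_nonneg (by linarith)), one_mul] at h3
  have h4 := mul_le_mul_of_nonneg_left h3 (Nat.cast_nonneg (α := ℝ) R)
  linarith [key t ht]

lemma IsLC.isW_assocFun (hM : IsLC M) (hβ : HasBeta3 M) : IsW (assocFun M) where
  toIsW0 := hM.isW0_assocFun
  om1 := hM.om1_assocFun hβ

end AssocFun

/-! ### Comparison of weight functions -/

section Functions

variable {ω τ f : ℝ → ℝ}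

/-- Makes an asymptotic bound global: on a bounded interval the increasing `f` is bounded by its
value at the right end. -/
lemma exists_le_of_isBigO (hf : MonotoneOn f (Set.Ici 0)) (hω : ∀ t, 0 ≤ t → 0 ≤ ω t)
    (h : f =O[atTop] ω) : ∃ C : ℝ, 1 ≤ C ∧ ∀ t, 0 ≤ t → f t ≤ C * ω t + C := by
  obtain ⟨c, hc⟩ := h.bound
  obtain ⟨T, hT⟩ := eventually_atTop.1 hc
  set T' := max T 0
  refine ⟨max (max 1 c) (f T'), (le_max_left _ _).trans (le_max_left _ _), fun t ht => ?_⟩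
  have h1 : (1 : ℝ) ≤ max (max 1 c) (f T') := (le_max_left _ _).trans (le_max_left _ _)
  rcases le_total T' t with h | h
  · have h2 := hT t ((le_max_left _ _).trans h)
    rw [Real.norm_of_nonneg (hω t ht)] at h2
    have h3 : c ≤ max (max 1 c) (f T') := (le_max_right _ _).trans (le_max_left _ _)
    have h4 := mul_le_mul_of_nonneg_right h3 (hω t ht)
    have h5 := Real.le_norm_self (f t)
    linarith
  · have h2 : f t ≤ f T' := hf ht (le_max_right T 0) h
    have h3 : f T' ≤ max (max 1 c) (f T') := le_max_right _ _
    have := mul_nonneg (zero_le_one.trans h1) (hω t ht)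
    linarith

lemma isBigO_of_eventually_le (hω : Tendsto ω atTop atTop) (hf : ∀ᶠ t in atTop, 0 ≤ f t)
    {C K : ℝ} (h : ∀ᶠ t in atTop, f t ≤ C * ω t + K) : f =O[atTop] ω := by
  refine IsBigO.of_bound (C + 1) ?_
  filter_upwards [h, hf, hω.eventually_ge_atTop K, hω.eventually_ge_atTop 0] with t h1 h2 h3 h4
  rw [Real.norm_of_nonneg h2, Real.norm_of_nonneg h4]
  linarith

/-- Iterating (ω₁) treats the dilations by `2 ^ n`, and monotonicity all smaller ones. -/
lemma IsW.exists_mul_le (hω : IsW ω) (h : ℝ) (hh : 0 ≤ h) :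
    ∃ L : ℝ, 1 ≤ L ∧ ∀ t, 0 ≤ t → ω (h * t) ≤ L * ω t + L := by
  have key : ∀ n : ℕ, (fun t => ω (2 ^ n * t)) =O[atTop] ω := by
    intro n
    induction n with
    | zero => simpa using isBigO_refl ω atTop
    | succ n ih =>
      have h1 : Tendsto (fun t : ℝ => 2 ^ n * t) atTop atTop :=
        tendsto_id.const_mul_atTop (by positivity)
      have h2 := (hω.om1.comp_tendsto h1).trans ih
      refine h2.congr_left fun t => ?_
      simp only [Function.comp, pow_succ']
      ring_nf
  obtain ⟨n, hn⟩ := pow_unbounded_of_one_lt h (one_lt_two (α := ℝ))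
  obtain ⟨L, hL, hLe⟩ := exists_le_of_isBigO (f := fun t => ω (2 ^ n * t)) (fun a ha b hb hab =>
    hω.monotoneOn (mul_nonneg (by positivity) (show (0 : ℝ) ≤ a from ha))
      (mul_nonneg (by positivity) (show (0 : ℝ) ≤ b from hb)) (mul_le_mul_of_nonneg_left hab (by positivity))) hω.nonneg (key n)
  refine ⟨L, hL, fun t ht => (hω.monotoneOn (mul_nonneg hh ht)
    (mul_nonneg (by positivity) ht) ?_).trans (hLe t ht)⟩
  exact mul_le_mul_of_nonneg_right hn.le ht

lemma FunEquiv.om1 (h : FunEquiv ω τ) (hω : Om1 ω) : Om1 τ := by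
  have h1 : Tendsto (fun t : ℝ => 2 * t) atTop atTop := tendsto_id.const_mul_atTop two_pos
  exact ((h.1.comp_tendsto h1).trans hω).trans h.2

lemma Om6.iterate (h : Om6 τ) (n : ℕ) :
    ∃ H K : ℝ, 1 ≤ H ∧ ∀ t, 0 ≤ t → 2 ^ n * τ t ≤ τ (H * t) + K := by
  obtain ⟨H, hH, hle⟩ := h
  induction n with
  | zero => exact ⟨1, 0, le_rfl, fun t _ => by simp⟩
  | succ n ih =>
    obtain ⟨G, K, hG, ih⟩ := ih
    refine ⟨H * G, H + 2 * K, one_le_mul_of_one_le_of_one_le hH hG, fun t ht => ?_⟩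
    have h1 := hle (G * t) (by positivity)
    have h2 := ih t ht
    rw [pow_succ', mul_assoc, mul_assoc]
    linarith

lemma FunEquiv.om6 (h : FunEquiv ω τ) (hω : IsW0 ω) (hτ : IsW0 τ) (h6 : Om6 τ) : Om6 ω := by
  obtain ⟨C, hC, h₁⟩ := exists_le_of_isBigO hτ.monotoneOn hω.nonneg h.1
  obtain ⟨D, hD, h₂⟩ := exists_le_of_isBigO hω.monotoneOn hτ.nonneg h.2
  -- (ω₆) for `τ` is iterated until `2 ^ n` beats the equivalence constants and the factor `2`
  -- wanted for `ω`.
  obtain ⟨n, hn⟩ := pow_unbounded_of_one_lt (2 * C * D) (one_lt_two (α := ℝ))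
  obtain ⟨H, K, hH, h6⟩ := h6.iterate n
  have key : ∀ t, 0 ≤ t → 2 * ω t ≤ ω (H * t) + (1 + |K| + 2 * D) := by
    intro t ht
    have a1 := h₂ t ht
    have a2 := h6 t ht
    have a3 := h₁ (H * t) (by positivity)
    have a4 := mul_le_mul_of_nonneg_right hn.le (hτ.nonneg t ht)
    have a5 : C * (2 * (D * τ t)) ≤ C * (ω (H * t) + 1 + |K|) := by
      have := le_mul_of_one_le_left (abs_nonneg K) hC
      have := le_abs_self K
      linarith
    have a6 := le_of_mul_le_mul_left a5 (by linarith)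
    linarith
  -- (ω₆) uses one number both as dilation and as additive constant, hence the maximum.
  refine ⟨max H (1 + |K| + 2 * D), hH.trans (le_max_left _ _), fun t ht =>
    (key t ht).trans (add_le_add (hω.monotoneOn ?_ ?_ ?_) (le_max_right _ _))⟩
  · exact mul_nonneg (by linarith) ht
  · exact mul_nonneg (by linarith [le_max_left H (1 + |K| + 2 * D)]) ht
  · exact mul_le_mul_of_nonneg_right (le_max_left _ _) ht

lemma FunEquiv.symm (h : FunEquiv ω τ) : FunEquiv τ ω := ⟨h.2, h.1⟩

lemma FunEquiv.trans (h : FunEquiv ω τ) (h' : FunEquiv τ f) : FunEquiv ω f :=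
  ⟨h'.1.trans h.1, h.2.trans h'.2⟩

end Functions

/-! ### Equivalent sequences have equivalent associated functions -/

section Sequences

variable {M N : ℕ → ℝ}

/-- `M ≼ N` gives `ω_N(t) ≤ ω_M(B t) + log K`, and (ω₁) for `ω_M` removes the dilation. -/
lemma isBigO_assocFun_of_seqLe (hM : IsLC M) (hN : IsLC N) (h : SeqLe M N)
    (hW : IsW (assocFun M)) : assocFun N =O[atTop] assocFun M := by
  obtain ⟨B, K, hB, hK, hle⟩ := h
  obtain ⟨L, hL, hLe⟩ := hW.exists_mul_le B (by linarith)
  refine isBigO_of_eventually_le hM.tendsto_assocFun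
    ((eventually_ge_atTop 0).mono fun t => hN.assocFun_nonneg) (C := L) (K := L + Real.log K) ?_
  filter_upwards [eventually_gt_atTop 0] with t ht
  rw [← add_assoc]
  refine le_trans (hN.assocFun_le ht (b := assocFun M (B * t) + Real.log K) fun p => ?_)
    (add_le_add_left (hLe t ht.le) _)
  have h1 := Real.log_le_log (hM.pos p) (hle p)
  have h2 := hM.le_assocFun (t := B * t) (by positivity) p
  have hNp := hN.pos p
  rw [Real.log_mul (by positivity) hNp.ne', Real.log_mul (by positivity) (by positivity),
    Real.log_pow] at h1
  rw [Real.log_mul (by positivity) ht.ne'] at h2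
  linarith

lemma exists_le_mul_of_eventually_le {a b : ℕ → ℝ} (hb : ∀ p, 0 < b p)
    (h : ∀ᶠ p in atTop, a p ≤ b p) : ∃ K : ℝ, 1 ≤ K ∧ ∀ p, a p ≤ K * b p := by
  have h1 : IsBoundedUnder (· ≤ ·) atTop fun p => a p / b p :=
    ⟨1, eventually_map.2 (h.mono fun p hp => (div_le_one (hb p)).2 hp)⟩
  obtain ⟨K, hK⟩ := h1.bddAbove_range
  refine ⟨max 1 K, le_max_left _ _, fun p => (div_le_iff₀ (hb p)).1 ?_⟩
  exact (hK (Set.mem_range_self p)).trans (le_max_right _ _)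

/-! ### Factorial lower bounds, (ω₂) and (ω₅) -/

lemma le_root_smallSeq_iff (hM : ∀ p, 0 < M p) {c : ℝ} (hc : 0 ≤ c) {p : ℕ} (hp : 0 < p) :
    c ≤ smallSeq M p ^ (1 / (p : ℝ)) ↔ c ^ p * p ! ≤ M p := by
  have hf : (0 : ℝ) < p ! := by exact_mod_cast Nat.factorial_pos p
  rw [smallSeq, one_div,
    Real.le_rpow_inv_iff_of_pos hc (div_pos (hM p) hf).le (by exact_mod_cast hp),
    Real.rpow_natCast, le_div_iff₀ hf]

/-- The spare factor `2 ^ p` eventually exceeds `K`, so no constant remains under the root. -/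
lemma eventually_le_root_smallSeq (hM : ∀ p, 0 < M p) {c K : ℝ} (hc : 0 ≤ c)
    (h : ∀ p, (2 * c) ^ p * p ! ≤ K * M p) :
    ∀ᶠ p : ℕ in atTop, c ≤ smallSeq M p ^ (1 / (p : ℝ)) := by
  filter_upwards [eventually_gt_atTop 0,
    (tendsto_pow_atTop_atTop_of_one_lt (one_lt_two (α := ℝ))).eventually_ge_atTop K] with p hp hK
  rw [le_root_smallSeq_iff hM hc hp]
  have h1 := (h p).trans (mul_le_mul_of_nonneg_right hK (hM p).le)
  rw [mul_pow, mul_assoc] at h1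
  exact le_of_mul_le_mul_left h1 (by positivity)

/-- In this form the condition visibly passes along `≼` and can be inserted into the associated
function; likewise for `liminfPos_iff`. -/
lemma limInfinite_iff (hM : ∀ p, 0 < M p) :
    LimInfinite M ↔ ∀ c : ℝ, 0 < c → ∃ K : ℝ, 1 ≤ K ∧ ∀ p, c ^ p * p ! ≤ K * M p := by
  refine ⟨fun h c hc => ?_, fun h => tendsto_atTop.2 fun b => ?_⟩
  · refine exists_le_mul_of_eventually_le (a := fun p => c ^ p * p !) hM ?_
    filter_upwards [eventually_gt_atTop 0, h.eventually_ge_atTop c] with p hp hcp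
    exact (le_root_smallSeq_iff hM hc.le hp).1 hcp
  · obtain ⟨K, -, hK⟩ := h (2 * max b 1) (by positivity)
    exact (eventually_le_root_smallSeq hM (by positivity) hK).mono fun p hp =>
      (le_max_left _ _).trans hp

lemma liminfPos_iff (hM : ∀ p, 0 < M p) :
    LiminfPos M ↔ ∃ c : ℝ, 0 < c ∧ ∃ K : ℝ, 1 ≤ K ∧ ∀ p, c ^ p * p ! ≤ K * M p := by
  refine ⟨fun h => ?_, fun ⟨c, hc, K, _, hK⟩ => ?_⟩
  · obtain ⟨c, hc0, hc⟩ := EReal.lt_iff_exists_real_btwn.1 h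
    have hc0 : 0 < c := by exact_mod_cast hc0
    refine ⟨c, hc0, exists_le_mul_of_eventually_le (a := fun p => c ^ p * p !) hM ?_⟩
    filter_upwards [eventually_gt_atTop 0, eventually_lt_of_lt_liminf hc] with p hp hcp
    exact (le_root_smallSeq_iff hM hc0.le hp).1 (EReal.coe_lt_coe_iff.1 hcp).le
  · refine lt_of_lt_of_le (b := ((c / 2 : ℝ) : EReal)) (by exact_mod_cast half_pos hc) ?_
    refine le_liminf_of_le (by isBoundedDefault) ?_
    refine (eventually_le_root_smallSeq hM (half_pos hc).le (K := K) ?_).mono fun p hp =>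
      EReal.coe_le_coe_iff.2 hp
    simpa [mul_div_cancel₀] using hK

lemma SeqLe.exists_factorial_le (h : SeqLe M N) : ∃ B D : ℝ, 1 ≤ B ∧ 1 ≤ D ∧ ∀ c K : ℝ, 1 ≤ K →
    (∀ p, (B * c) ^ p * p ! ≤ K * M p) → ∀ p, c ^ p * p ! ≤ D * K * N p := by
  obtain ⟨B, D, hB, hD, hle⟩ := h
  refine ⟨B, D, hB, hD, fun c K hK hc p => ?_⟩
  have h1 := (hc p).trans (mul_le_mul_of_nonneg_left (hle p) (by linarith))
  have hBp : 0 < B ^ p := by positivity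
  rw [mul_pow, mul_assoc] at h1
  refine le_of_mul_le_mul_left (h1.trans (le_of_eq ?_)) hBp
  ring

lemma LimInfinite.of_seqLe (hM : ∀ p, 0 < M p) (hN : ∀ p, 0 < N p) (h : SeqLe M N)
    (hlim : LimInfinite M) : LimInfinite N := by
  obtain ⟨B, D, hB, hD, hle⟩ := h.exists_factorial_le
  refine (limInfinite_iff hN).2 fun c hc => ?_
  obtain ⟨K, hK, hcK⟩ := (limInfinite_iff hM).1 hlim (B * c) (by positivity)
  exact ⟨D * K, one_le_mul_of_one_le_of_one_le hD hK, hle c K hK hcK⟩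

lemma LiminfPos.of_seqLe (hM : ∀ p, 0 < M p) (hN : ∀ p, 0 < N p) (h : SeqLe M N)
    (hlim : LiminfPos M) : LiminfPos N := by
  obtain ⟨B, D, hB, hD, hle⟩ := h.exists_factorial_le
  obtain ⟨c, hc, K, hK, hcK⟩ := (liminfPos_iff hM).1 hlim
  refine (liminfPos_iff hN).2 ⟨c / B, by positivity, D * K, one_le_mul_of_one_le_of_one_le hD hK,
    hle _ K hK ?_⟩
  rwa [mul_div_cancel₀ _ (by positivity)]

/-- `t^p / M_p ≤ K (t/c)^p / p! ≤ K exp (t/c)`. -/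
lemma IsLC.assocFun_le_div (hM : IsLC M) {c K : ℝ} (hc : 0 < c) (hK : 1 ≤ K)
    (h : ∀ p, c ^ p * p ! ≤ K * M p) {t : ℝ} (ht : 0 < t) :
    assocFun M t ≤ t / c + Real.log K := by
  refine hM.assocFun_le ht fun p => ?_
  have hf : (0 : ℝ) < p ! := by exact_mod_cast Nat.factorial_pos p
  have h1 := Real.log_le_log (by positivity) (Real.pow_div_factorial_le_exp _ (div_pos ht hc).le p)
  have h2 := Real.log_le_log (by positivity) (h p)
  rw [Real.log_exp, Real.log_div (by positivity) hf.ne', Real.log_pow,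
    Real.log_div ht.ne' hc.ne'] at h1
  rw [Real.log_mul (by positivity) hf.ne', Real.log_pow,
    Real.log_mul (by positivity) (hM.pos p).ne'] at h2
  linarith

lemma IsLC.om2_assocFun (hM : IsLC M) (h : LiminfPos M) : Om2 (assocFun M) := by
  obtain ⟨c, hc, K, hK, hcK⟩ := (liminfPos_iff hM.pos).1 h
  refine isBigO_of_eventually_le tendsto_id
    ((eventually_ge_atTop 0).mono fun t => hM.assocFun_nonneg) (C := 1 / c) (K := Real.log K) ?_
  filter_upwards [eventually_gt_atTop 0] with t ht
  simpa [div_eq_inv_mul] using hM.assocFun_le_div hc hK hcK ht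

lemma IsLC.om5_assocFun (hM : IsLC M) (h : LimInfinite M) : Om5 (assocFun M) := by
  refine isLittleO_iff.2 fun ε hε => ?_
  -- With `c = 2 / ε` the linear term is `ε t / 2`; the other half of `ε t` absorbs `log K`.
  obtain ⟨K, hK, hcK⟩ := (limInfinite_iff hM.pos).1 h (2 / ε) (by positivity)
  filter_upwards [eventually_gt_atTop 0, eventually_ge_atTop (2 / ε * Real.log K)] with t ht htK
  rw [Real.norm_of_nonneg (hM.assocFun_nonneg ht.le), Real.norm_of_nonneg ht.le]
  have h1 := hM.assocFun_le_div (by positivity) hK hcK ht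
  have h2 : Real.log K ≤ ε / 2 * t := by
    have := mul_le_mul_of_nonneg_left htK (half_pos hε).le
    calc Real.log K = ε / 2 * (2 / ε * Real.log K) := by field_simp
      _ ≤ _ := this
  have h3 : t / (2 / ε) = ε / 2 * t := by field_simp
  linarith

end Sequences

/-! ### The matrix associated with a weight function -/

section Matrix

variable {ω : ℝ → ℝ}

lemma IsW0.exp_monotone (hω : IsW0 ω) : Monotone fun y => ω (Real.exp y) := fun _ _ h =>
  hω.monotoneOn (Real.exp_pos _).le (Real.exp_pos _).le (Real.exp_le_exp.2 h)

/-- By (ω₃), `(|x| + 1) y ≤ ω (exp y)` beyond some `Y`, so only `y ≤ Y` matters. -/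
lemma IsW0.bddAbove_youngConj (hω : IsW0 ω) (x : ℝ) :
    BddAbove ((fun y : ℝ => x * y - ω (Real.exp y)) '' Set.Ici 0) := by
  have h := hω.om3.bound (c := 1 / (|x| + 1)) (by positivity)
  obtain ⟨Y, hY⟩ := eventually_atTop.1 (Real.tendsto_exp_atTop.eventually h)
  refine ⟨|x| * |Y|, ?_⟩
  rintro _ ⟨y, hy, rfl⟩
  have hy : 0 ≤ y := hy
  have hω0 := hω.nonneg _ (Real.exp_pos y).le
  have hxy : x * y ≤ |x| * y := mul_le_mul_of_nonneg_right (le_abs_self x) hy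
  rcases le_total Y y with h | h
  · have h1 := hY y h
    rw [Real.log_exp, Real.norm_of_nonneg hy, Real.norm_of_nonneg hω0, one_div,
      inv_mul_eq_div, le_div_iff₀ (by positivity)] at h1
    have := mul_nonneg (abs_nonneg x) (abs_nonneg Y)
    simp only
    linarith
  · have h1 : |x| * y ≤ |x| * |Y| :=
      mul_le_mul_of_nonneg_left (h.trans (le_abs_self Y)) (abs_nonneg x)
    simp only
    linarith

lemma log_assocMatrix (l : ℝ) (j : ℕ) :
    Real.log (assocMatrix ω l j) = 1 / l * youngConj ω (l * j) := Real.log_exp _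

lemma assocMatrix_pos (l : ℝ) (j : ℕ) : 0 < assocMatrix ω l j := Real.exp_pos _

/-- Together with `log_assocMatrix_le` this replaces the conjugate by a supremum of functions affine
in `j`, the only description of the matrix used from here on. -/
lemma IsW0.le_log_assocMatrix (hω : IsW0 ω) {l : ℝ} (hl : 0 < l) (j : ℕ) {y : ℝ} (hy : 0 ≤ y) :
    j * y - ω (Real.exp y) / l ≤ Real.log (assocMatrix ω l j) := by
  rw [log_assocMatrix, one_div, inv_mul_eq_div, le_div_iff₀ hl, sub_mul, div_mul_cancel₀ _ hl.ne']
  have h := le_csSup (hω.bddAbove_youngConj (l * j)) ⟨y, hy, rfl⟩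
  simp only at h
  rw [youngConj]
  linarith

lemma log_assocMatrix_le {l : ℝ} (hl : 0 < l) {j : ℕ} {b : ℝ}
    (h : ∀ y, 0 ≤ y → j * y - ω (Real.exp y) / l ≤ b) : Real.log (assocMatrix ω l j) ≤ b := by
  rw [log_assocMatrix, one_div, inv_mul_eq_div, div_le_iff₀ hl]
  refine csSup_le (Set.nonempty_Ici.image _) ?_
  rintro _ ⟨y, hy, rfl⟩
  have h1 := mul_le_mul_of_nonneg_right (h y hy) hl.le
  rw [sub_mul, div_mul_cancel₀ _ hl.ne'] at h1
  simp only
  linarith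

lemma IsW0.isLC_assocMatrix (hω : IsW0 ω) {l : ℝ} (hl : 0 < l) : IsLC (assocMatrix ω l) where
  pos := assocMatrix_pos l
  zero := by
    have h1 : ω (Real.exp 0) = 0 := hω.normalized _ (by simp)
    have h2 := hω.le_log_assocMatrix hl 0 le_rfl
    have h3 : Real.log (assocMatrix ω l 0) ≤ 0 := log_assocMatrix_le hl fun y hy => by
      have := div_nonneg (hω.nonneg _ (Real.exp_pos y).le) hl.le
      simpa using this
    rw [h1] at h2
    have h4 : Real.log (assocMatrix ω l 0) = 0 := le_antisymm h3 (by simpa using h2)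
    rw [← Real.exp_log (assocMatrix_pos l 0), h4, Real.exp_zero]
  one := by
    have h1 : ω (Real.exp 0) = 0 := hω.normalized _ (by simp)
    have h2 := hω.le_log_assocMatrix hl 1 le_rfl
    rw [h1] at h2
    exact (Real.log_nonneg_iff (assocMatrix_pos l 1)).1 (by simpa using h2)
  logConvex j := by
    rw [← Real.log_le_log_iff (pow_pos (assocMatrix_pos _ _) _)
      (mul_pos (assocMatrix_pos _ _) (assocMatrix_pos _ _)), Real.log_pow,
      Real.log_mul (assocMatrix_pos _ _).ne' (assocMatrix_pos _ _).ne']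
    have h : Real.log (assocMatrix ω l (j + 1)) ≤
        (Real.log (assocMatrix ω l j) + Real.log (assocMatrix ω l (j + 2))) / 2 :=
      log_assocMatrix_le hl fun y hy => by
        have h1 := hω.le_log_assocMatrix hl j hy
        have h2 := hω.le_log_assocMatrix hl (j + 2) hy
        push_cast at h1 h2 ⊢
        linarith
    push_cast
    linarith
  root_tendsto := by
    refine tendsto_atTop.2 fun b => ?_
    -- A single test point: the summand `1` contributes `j`, which eventually outweighs `ω (exp y) /
    -- l`.
    set y := Real.log (max b 1) + 1 with hy
    have hy0 : 0 ≤ y := by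
      have := Real.log_nonneg (le_max_right b 1)
      linarith
    filter_upwards [eventually_gt_atTop 0,
      tendsto_natCast_atTop_atTop.eventually_ge_atTop (ω (Real.exp y) / l)] with j hj hjω
    have hj' : (0 : ℝ) < j := by exact_mod_cast hj
    have h1 := hω.le_log_assocMatrix hl j hy0
    have hb : 0 < max b 1 := lt_max_of_lt_right one_pos
    refine (le_max_left b 1).trans ?_
    rw [one_div, Real.le_rpow_inv_iff_of_pos hb.le (assocMatrix_pos l j).le hj',
      Real.rpow_natCast, ← Real.log_le_log_iff (pow_pos hb _) (assocMatrix_pos l j), Real.log_pow]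
    rw [hy, mul_add, mul_one, ← hy] at h1
    linarith

lemma IsW0.assocMatrix_mono (hω : IsW0 ω) {l l' : ℝ} (hl : 0 < l) (h : l ≤ l') (j : ℕ) :
    assocMatrix ω l j ≤ assocMatrix ω l' j := by
  rw [← Real.log_le_log_iff (assocMatrix_pos _ _) (assocMatrix_pos _ _)]
  refine log_assocMatrix_le hl fun y hy =>
    le_trans ?_ (hω.le_log_assocMatrix (hl.trans_le h) j hy)
  have := div_le_div_of_nonneg_left (hω.nonneg _ (Real.exp_pos y).le) hl h
  linarith

/-- `ω / l` is split into two equal halves, one for each index; this is the source of (mg). -/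
lemma IsW0.assocMatrix_add_le (hω : IsW0 ω) {l : ℝ} (hl : 0 < l) (j k : ℕ) :
    assocMatrix ω l (j + k) ≤ assocMatrix ω (2 * l) j * assocMatrix ω (2 * l) k := by
  rw [← Real.log_le_log_iff (assocMatrix_pos _ _) (mul_pos (assocMatrix_pos _ _)
    (assocMatrix_pos _ _)), Real.log_mul (assocMatrix_pos _ _).ne' (assocMatrix_pos _ _).ne']
  refine log_assocMatrix_le hl fun y hy => ?_
  have h1 := hω.le_log_assocMatrix (mul_pos two_pos hl) j hy
  have h2 := hω.le_log_assocMatrix (mul_pos two_pos hl) k hy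
  have h3 : ω (Real.exp y) / l = 2 * (ω (Real.exp y) / (2 * l)) := by field_simp
  push_cast
  linarith

/-- At equal indices the splitting loses nothing, since both halves are maximised by the same `y`.
This moves equivalences between `l` and `2l`. -/
lemma IsW0.assocMatrix_sq_le (hω : IsW0 ω) {l : ℝ} (hl : 0 < l) (j : ℕ) :
    assocMatrix ω (2 * l) j ^ 2 ≤ assocMatrix ω l (j + j) := by
  rw [← Real.log_le_log_iff (pow_pos (assocMatrix_pos _ _) _) (assocMatrix_pos _ _), Real.log_pow]
  have h : Real.log (assocMatrix ω (2 * l) j) ≤ Real.log (assocMatrix ω l (j + j)) / 2 :=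
    log_assocMatrix_le (mul_pos two_pos hl) fun y hy => by
      have h2 := hω.le_log_assocMatrix hl (j + j) hy
      have h3 : ω (Real.exp y) / l = 2 * (ω (Real.exp y) / (2 * l)) := by field_simp
      push_cast at h2
      linarith
  push_cast
  linarith

/-- Under (ω₁), geometric factors are absorbed by a change of the matrix parameter. -/
lemma IsW.exists_pow_mul_assocMatrix_le (hω : IsW ω) {h : ℝ} (hh : 1 ≤ h) :
    ∃ L : ℝ, 1 ≤ L ∧ ∀ l : ℝ, 0 < l → ∃ C : ℝ, 0 < C ∧
      ∀ j, h ^ j * assocMatrix ω l j ≤ C * assocMatrix ω (L * l) j := by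
  obtain ⟨L, hL, hle⟩ := hω.exists_mul_le h (by linarith)
  refine ⟨L, hL, fun l hl => ⟨Real.exp (1 / l), Real.exp_pos _, fun j => ?_⟩⟩
  have hh0 : 0 < h := by linarith
  rw [← Real.log_le_log_iff (mul_pos (pow_pos hh0 _) (assocMatrix_pos _ _))
    (mul_pos (Real.exp_pos _) (assocMatrix_pos _ _)), Real.log_mul (pow_pos hh0 _).ne'
    (assocMatrix_pos _ _).ne', Real.log_mul (Real.exp_pos _).ne' (assocMatrix_pos _ _).ne',
    Real.log_exp, Real.log_pow]
  have hLl : 0 < L * l := by positivity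
  suffices H : Real.log (assocMatrix ω l j) ≤
      1 / l + Real.log (assocMatrix ω (L * l) j) - j * Real.log h by linarith
  refine log_assocMatrix_le hl fun y hy => ?_
  -- Shifting the test point by `log h` produces the factor `h ^ j`. The bound on `ω (h * exp y)`,
  -- divided by `L * l`, leaves `1 / l`, whence the constant `exp (1 / l)`.
  have h1 := hω.le_log_assocMatrix hLl j (y := y + Real.log h)
    (add_nonneg hy (Real.log_nonneg hh))
  have h2 := hle (Real.exp y) (Real.exp_pos y).le
  rw [Real.exp_add, Real.exp_log hh0, mul_comm _ h] at h1
  have h3 : ω (h * Real.exp y) / (L * l) ≤ ω (Real.exp y) / l + 1 / l := by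
    rw [div_le_iff₀ hLl]
    refine h2.trans (le_of_eq ?_)
    field_simp
  linarith

/-- The first weight of the matrix associated with `ω_N` is `N` itself. -/
lemma IsLC.assocMatrix_assocFun_one {N : ℕ → ℝ} (hN : IsLC N) (j : ℕ) :
    assocMatrix (assocFun N) 1 j = N j := by
  refine Real.log_injOn_pos (assocMatrix_pos _ _) (hN.pos j) (le_antisymm ?_ ?_)
  · refine log_assocMatrix_le one_pos fun y hy => ?_
    have := hN.le_assocFun (Real.exp_pos y) j
    rw [Real.log_exp] at this
    rw [div_one]
    linarith
  -- The supremum is tested at `y = log q`: by log-convexity, the index `j` attains `ω_N(q)`.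
  · set q := N (j + 1) / N j with hq
    have hq1 : 1 ≤ q := hN.one_le_quotSeq (j + 1)
    have hq0 : 0 < q := by linarith
    refine le_trans ?_ (hN.isW0_assocFun.le_log_assocMatrix one_pos j (Real.log_nonneg hq1))
    rw [Real.exp_log hq0, div_one]
    have h1 : assocFun N q ≤ j * Real.log q - Real.log (N j) := hN.assocFun_le hq0 fun p => by
      have h := Real.log_le_log (mul_pos (pow_pos hq0 _) (hN.pos _))
        (logConvex_support hN.pos hN.logConvex j p)
      rw [Real.log_mul (pow_pos hq0 _).ne' (hN.pos _).ne', Real.log_mul (pow_pos hq0 _).ne'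
        (hN.pos _).ne', Real.log_pow, Real.log_pow] at h
      linarith
    linarith

lemma exists_subgradient {g : ℝ → ℝ} (hg : ConvexOn ℝ Set.univ g) (y₀ : ℝ) :
    ∃ x, ∀ y, g y₀ + x * (y - y₀) ≤ g y := by
  refine ⟨derivWithin g (Set.Ioi y₀) y₀, fun y => ?_⟩
  have hi : y₀ ∈ interior (Set.univ : Set ℝ) := by simp
  rcases lt_trichotomy y y₀ with h | rfl | h
  · have h1 := (hg.slope_le_leftDeriv_of_mem_interior (Set.mem_univ y) hi h).trans
      (hg.leftDeriv_le_rightDeriv_of_mem_interior hi)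
    rw [slope_def_field, div_le_iff₀ (sub_pos.2 h)] at h1
    linarith
  · simp
  · have h1 := hg.rightDeriv_le_slope_of_mem_interior hi (Set.mem_univ y) h
    rw [slope_def_field, le_div_iff₀ (sub_pos.2 h)] at h1
    linarith

/-- Biconjugation restricted to integer indices. A subgradient `x` of `ω ∘ exp` at `log t` points to
the index `x / l`; rounding it down costs at most `l * log t`. -/
lemma IsW0.le_assocFun_assocMatrix (hω : IsW0 ω) {l : ℝ} (hl : 0 < l) {t : ℝ} (ht : 1 ≤ t) :
    ω t ≤ l * assocFun (assocMatrix ω l) t + l * Real.log t := by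
  have ht0 : 0 < t := by linarith
  set y₀ := Real.log t with hy₀
  have hty : Real.exp y₀ = t := Real.exp_log ht0
  have hy0 : 0 ≤ y₀ := Real.log_nonneg ht
  obtain ⟨x, hx⟩ := exists_subgradient hω.om4 y₀
  simp only [hty] at hx
  have hx0 : 0 ≤ x := by
    have h1 := hx (y₀ - 1)
    have h2 : ω (Real.exp (y₀ - 1)) ≤ ω (Real.exp y₀) := hω.exp_monotone (by linarith)
    rw [hty] at h2
    linarith
  set p := ⌊x / l⌋₊ with hp
  have hp1 : p * l ≤ x := (le_div_iff₀ hl).1 (Nat.floor_le (div_nonneg hx0 hl.le))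
  have hp2 : x < (p + 1) * l := (div_lt_iff₀ hl).1 (Nat.lt_floor_add_one _)
  have h1 : Real.log (assocMatrix ω l p) ≤ (x * y₀ - ω t) / l := by
    refine log_assocMatrix_le hl fun y hy => ?_
    rw [le_div_iff₀ hl, sub_mul, div_mul_cancel₀ _ hl.ne']
    have := hx y
    have := mul_le_mul_of_nonneg_right hp1 hy
    linarith
  have h2 := (hω.isLC_assocMatrix hl).le_assocFun ht0 p
  rw [le_div_iff₀ hl] at h1
  have h3 := mul_le_mul_of_nonneg_left h2 hl.le
  have h4 := mul_le_mul_of_nonneg_right hp2.le hy0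
  linarith

lemma IsW0.assocFun_assocMatrix_le (hω : IsW0 ω) {l : ℝ} (hl : 0 < l) {t : ℝ} (ht : 1 ≤ t) :
    assocFun (assocMatrix ω l) t ≤ 1 / l * ω t := by
  have ht0 : 0 < t := by linarith
  refine (hω.isLC_assocMatrix hl).assocFun_le ht0 fun p => ?_
  have h := hω.le_log_assocMatrix hl p (Real.log_nonneg ht)
  rw [Real.exp_log ht0] at h
  rw [one_div, inv_mul_eq_div]
  linarith

lemma IsW0.funEquiv_assocFun_assocMatrix (hω : IsW0 ω) {l : ℝ} (hl : 0 < l) :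
    FunEquiv (assocFun (assocMatrix ω l)) ω := by
  have hM := hω.isLC_assocMatrix hl
  constructor
  · refine isBigO_of_eventually_le hM.tendsto_assocFun ((eventually_ge_atTop 0).mono hω.nonneg)
      (C := 2 * l) (K := 0) ?_
    -- By (ω₃) the rounding error `l * log t` is at most `ω t / 2`, hence the constant `2 * l`.
    filter_upwards [eventually_ge_atTop 1,
      hω.om3.bound (c := 1 / (2 * l)) (by positivity)] with t ht h
    have h1 := hω.le_assocFun_assocMatrix hl ht
    rw [Real.norm_of_nonneg (Real.log_nonneg ht), Real.norm_of_nonneg (hω.nonneg t (by linarith)),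
      one_div, inv_mul_eq_div, le_div_iff₀ (by positivity)] at h
    linarith
  · refine isBigO_of_eventually_le hω.tendsto
      ((eventually_ge_atTop 0).mono fun t => hM.assocFun_nonneg) (C := 1 / l) (K := 0) ?_
    filter_upwards [eventually_ge_atTop 1] with t ht
    simpa using hω.assocFun_assocMatrix_le hl ht

lemma IsW.isW_assocFun_assocMatrix (hω : IsW ω) {l : ℝ} (hl : 0 < l) :
    IsW (assocFun (assocMatrix ω l)) where
  toIsW0 := (hω.isLC_assocMatrix hl).isW0_assocFun
  om1 := (hω.funEquiv_assocFun_assocMatrix hl).symm.om1 hω.om1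

/-- If `N` is squeezed between two members of the matrix, it has moderate growth. -/
lemma IsW0.hasMg_of_seqLe (hω : IsW0 ω) {N : ℕ → ℝ} (hN : IsLC N) {l : ℝ} (hl : 0 < l)
    (h₁ : SeqLe N (assocMatrix ω l)) (h₂ : SeqLe (assocMatrix ω (2 * l)) N) : HasMg N := by
  obtain ⟨B, K, hB, hK, h₁⟩ := h₁
  obtain ⟨B', K', hB', hK', h₂⟩ := h₂
  refine hN.hasMg_of_le (K := K * K' * K') (B := B * B') (one_le_mul_of_one_le_of_one_le
    (one_le_mul_of_one_le_of_one_le hK hK') hK') (one_le_mul_of_one_le_of_one_le hB hB')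
    fun j k => ?_
  have hj := hN.pos j
  have hk := hN.pos k
  have hk' := assocMatrix_pos (ω := ω) (2 * l) k
  calc N (j + k) ≤ K * B ^ (j + k) * assocMatrix ω l (j + k) := h₁ _
    _ ≤ K * B ^ (j + k) * ((K' * B' ^ j * N j) * (K' * B' ^ k * N k)) := by
      refine mul_le_mul_of_nonneg_left ((hω.assocMatrix_add_le hl j k).trans ?_) (by positivity)
      exact mul_le_mul (h₂ j) (h₂ k) hk'.le (by positivity)
    _ = _ := by rw [mul_pow, pow_add B']; ring

/-- `assocMatrix_sq_le` controls even indices only. An odd index `p = 2j + 1` is reached by (mg)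
with second index `1` and by monotonicity of `M`. -/
lemma IsLC.seqLe_of_even {M N : ℕ → ℝ} (hN : IsLC N) (hM : IsLC M) (hmg : HasMg N)
    {B K : ℝ} (hB : 1 ≤ B) (hK : 1 ≤ K) (h : ∀ j, N (j + j) ≤ K * B ^ j * M (j + j)) :
    SeqLe N M := by
  obtain ⟨A, hA, hmg⟩ := hmg
  have hN1 := hN.one
  refine ⟨A * B, K * A * N 1, one_le_mul_of_one_le_of_one_le hA hB,
    one_le_mul_of_one_le_of_one_le (one_le_mul_of_one_le_of_one_le hK hA) hN1, fun p => ?_⟩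
  obtain ⟨j, hj⟩ := Nat.even_or_odd' p
  have hMj := hM.pos (j + j)
  have hpow : K * B ^ j * M (j + j) ≤ K * B ^ p * M p := by
    have := hM.monotone (show j + j ≤ p by omega)
    have := pow_le_pow_right₀ hB (show j ≤ p by omega)
    gcongr
  have hMp := hM.pos p
  have hstep : N p ≤ A ^ (p + 1) * N 1 * N (j + j) := by
    have hNj := hN.pos (j + j)
    rcases hj with hj | hj
    · rw [show j + j = p by omega]
      have := hN.pos p
      refine le_mul_of_one_le_left this.le (one_le_mul_of_one_le_of_one_le (one_le_pow₀ hA) hN1)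
    · have h1 := hmg (j + j) 1
      rw [show j + j + 1 = p by omega] at h1
      have : A ^ p ≤ A ^ (p + 1) := pow_le_pow_right₀ hA (Nat.le_succ p)
      calc N p ≤ A ^ p * N (j + j) * N 1 := h1
        _ ≤ A ^ (p + 1) * N (j + j) * N 1 := by gcongr
        _ = _ := by ring
  calc N p ≤ A ^ (p + 1) * N 1 * N (j + j) := hstep
    _ ≤ A ^ (p + 1) * N 1 * (K * B ^ p * M p) := by
      have := (h j).trans hpow
      gcongr
    _ = _ := by rw [mul_pow]; ring

/-- If one member of the matrix is equivalent to a sequence of moderate growth, all are. -/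
lemma IsW0.seqEquiv_assocMatrix (hω : IsW0 ω) {N : ℕ → ℝ} (hN : IsLC N) (hmg : HasMg N)
    {l₀ : ℝ} (hl₀ : 0 < l₀) (h : SeqEquiv N (assocMatrix ω l₀)) {l : ℝ} (hl : 0 < l) :
    SeqEquiv N (assocMatrix ω l) := by
  -- Doubling: `(Ω^{2l}_p)² ≤ Ω^l_{2p}`, which is bounded through `N_{2p} ≤ A^{2p} N_p²`; then take
  -- square roots.
  have hup : ∀ n : ℕ, SeqEquiv N (assocMatrix ω (2 ^ n * l₀)) := by
    intro n
    induction n with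
    | zero => simpa using h
    | succ n ih =>
      have hp : 0 < 2 ^ n * l₀ := by positivity
      refine ⟨ih.1.trans ⟨1, 1, le_rfl, le_rfl, fun p => ?_⟩, ?_⟩
      · have := hω.assocMatrix_mono hp (l' := 2 ^ (n + 1) * l₀)
          (by rw [pow_succ]; linarith) p
        simpa using this
      · obtain ⟨B, K, hB, hK, hle⟩ := ih.2
        obtain ⟨A, hA, hmg⟩ := hmg
        refine ⟨A * B, K, one_le_mul_of_one_le_of_one_le hA hB, hK, fun p => ?_⟩
        have hNp := hN.pos p
        refine le_of_pow_le_pow_left₀ two_ne_zero (by positivity) ?_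
        rw [show (2 : ℝ) ^ (n + 1) * l₀ = 2 * (2 ^ n * l₀) by ring]
        calc _ ≤ assocMatrix ω (2 ^ n * l₀) (p + p) := hω.assocMatrix_sq_le hp p
          _ ≤ K * B ^ (p + p) * N (p + p) := hle _
          _ ≤ K ^ 2 * B ^ (p + p) * (A ^ (p + p) * N p * N p) := by
            have := hmg p p
            have := le_self_pow₀ hK two_ne_zero
            have := hN.pos (p + p)
            gcongr
          _ = _ := by rw [pow_add, pow_add, mul_pow, mul_pow, mul_pow]; ring
  -- Halving: `N_{2j} ≤ A^{2j} N_j²`, and `N_j²` is bounded through `(Ω^l_j)² ≤ Ω^{l/2}_{2j}`.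
  have hdown : ∀ n : ℕ, SeqEquiv N (assocMatrix ω (l₀ / 2 ^ n)) := by
    intro n
    induction n with
    | zero => simpa using h
    | succ n ih =>
      have hp : 0 < l₀ / 2 ^ (n + 1) := by positivity
      have h2 : 2 * (l₀ / 2 ^ (n + 1)) = l₀ / 2 ^ n := by rw [pow_succ]; field_simp
      refine ⟨?_, SeqLe.trans ⟨1, 1, le_rfl, le_rfl, fun p => ?_⟩ ih.2⟩
      · obtain ⟨B, K, hB, hK, hle⟩ := ih.1
        obtain ⟨A, hA, hA'⟩ := id hmg
        refine hN.seqLe_of_even (hω.isLC_assocMatrix hp) hmg (B := (A * B) ^ 2) (K := K ^ 2)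
          (one_le_pow₀ (one_le_mul_of_one_le_of_one_le hA hB)) (one_le_pow₀ hK) fun j => ?_
        have hNj := hN.pos j
        have h3 := hω.assocMatrix_sq_le hp j
        rw [h2] at h3
        have h4 := assocMatrix_pos (ω := ω) (l₀ / 2 ^ n) j
        calc N (j + j) ≤ A ^ (j + j) * N j * N j := hA' j j
          _ ≤ A ^ (j + j) * (K * B ^ j * assocMatrix ω (l₀ / 2 ^ n) j) *
              (K * B ^ j * assocMatrix ω (l₀ / 2 ^ n) j) := by
            have := hle j
            gcongr
          _ = K ^ 2 * ((A * B) ^ 2) ^ j * assocMatrix ω (l₀ / 2 ^ n) j ^ 2 := by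
            rw [pow_add, ← pow_mul, mul_comm 2 j, pow_mul, mul_pow A B]; ring
          _ ≤ _ := by gcongr
      · have := hω.assocMatrix_mono hp (l' := l₀ / 2 ^ n) (by linarith) p
        simpa using this
  -- A general `l` lies between two dyadic multiples of `l₀`, and the matrix increases in `l`.
  obtain ⟨n, hn⟩ := pow_unbounded_of_one_lt (max (l / l₀) (l₀ / l)) (one_lt_two (α := ℝ))
  have h1 : l ≤ 2 ^ n * l₀ := (div_le_iff₀ hl₀).1 ((le_max_left _ _).trans hn.le)
  have h2 : l₀ / 2 ^ n ≤ l := by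
    rw [div_le_iff₀ (by positivity), mul_comm]
    exact (div_le_iff₀ hl).1 ((le_max_right _ _).trans hn.le)
  refine ⟨(hdown n).1.trans ⟨1, 1, le_rfl, le_rfl, fun p => ?_⟩,
    SeqLe.trans ⟨1, 1, le_rfl, le_rfl, fun p => ?_⟩ (hup n).2⟩
  · simpa using hω.assocMatrix_mono (by positivity) h2 p
  · simpa using hω.assocMatrix_mono hl h1 p

end Matrix

/-! ### Lacunary trigonometric series -/

section Series

/-- Real part plus imaginary part of `exp (i t)`: the absolute value of every derivative at `0`
is `1`. -/
noncomputable def cosAddSin (t : ℝ) : ℝ := Real.cos t + Real.sin t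

lemma contDiff_cosAddSin {n : WithTop ℕ∞} : ContDiff ℝ n cosAddSin :=
  Real.contDiff_cos.add Real.contDiff_sin

lemma iteratedDeriv_cosAddSin (k : ℕ) (t : ℝ) :
    iteratedDeriv k cosAddSin t = iteratedDeriv k Real.cos t + iteratedDeriv k Real.sin t :=
  iteratedDeriv_fun_add Real.contDiff_cos.contDiffAt Real.contDiff_sin.contDiffAt

lemma abs_iteratedDeriv_cosAddSin_le (k : ℕ) (t : ℝ) : |iteratedDeriv k cosAddSin t| ≤ 2 := by
  rw [iteratedDeriv_cosAddSin]
  refine (abs_add_le _ _).trans ?_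
  linarith [Real.abs_iteratedDeriv_cos_le_one k t, Real.abs_iteratedDeriv_sin_le_one k t]

lemma abs_iteratedDeriv_cosAddSin_zero (k : ℕ) : |iteratedDeriv k cosAddSin 0| = 1 := by
  rw [iteratedDeriv_cosAddSin]
  obtain ⟨m, rfl | rfl⟩ := Nat.even_or_odd' k
  · rw [Real.iteratedDeriv_even_cos, Real.iteratedDeriv_even_sin]
    simp
  · rw [Real.iteratedDeriv_odd_cos, Real.iteratedDeriv_odd_sin]
    simp

lemma iteratedDeriv_cosAddSin_affine (c τ b : ℝ) (k : ℕ) (t : ℝ) :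
    iteratedDeriv k (fun t => c * cosAddSin (τ * (t - b))) t =
      c * τ ^ k * iteratedDeriv k cosAddSin (τ * (t - b)) := by
  rw [iteratedDeriv_const_mul_field, mul_assoc]
  congr 1
  have h1 := congrFun (iteratedDeriv_comp_sub_const k (fun t => cosAddSin (τ * t)) b) t
  rw [h1, congrFun (iteratedDeriv_comp_const_mul contDiff_cosAddSin τ) (t - b)]

/-- At `b` the `k`-th derivatives of all terms carry the same sign, so nothing cancels and the sum
is attained exactly. -/
lemma exists_trigSeries {c τ : ℕ → ℝ} (hc : ∀ n, 0 ≤ c n) (hτ : ∀ n, 0 ≤ τ n)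
    (hsum : ∀ k, Summable fun n => c n * τ n ^ k) (b : ℝ) :
    ∃ g : ℝ → ℝ, ContDiff ℝ ((⊤ : ℕ∞) : WithTop ℕ∞) g ∧
      (∀ k t, |iteratedDeriv k g t| ≤ 2 * ∑' n, c n * τ n ^ k) ∧
      ∀ k, |iteratedDeriv k g b| = ∑' n, c n * τ n ^ k := by
  set u : ℕ → ℝ → ℝ := fun n t => c n * cosAddSin (τ n * (t - b)) with hu
  have hudiff : ∀ n, ContDiff ℝ ((⊤ : ℕ∞) : WithTop ℕ∞) (u n) := fun n =>
    contDiff_const.mul (contDiff_cosAddSin.comp (contDiff_const.mul (contDiff_id.sub contDiff_const)))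
  have hnn : ∀ k n, 0 ≤ c n * τ n ^ k := fun k n => mul_nonneg (hc n) (pow_nonneg (hτ n) k)
  have hbound : ∀ k n t, ‖iteratedFDeriv ℝ k (u n) t‖ ≤ 2 * (c n * τ n ^ k) := by
    intro k n t
    rw [norm_iteratedFDeriv_eq_norm_iteratedDeriv,
      iteratedDeriv_cosAddSin_affine (c n) (τ n) b k t, norm_mul,
      Real.norm_of_nonneg (hnn k n), mul_comm]
    exact mul_le_mul_of_nonneg_right (abs_iteratedDeriv_cosAddSin_le k _) (hnn k n)
  have hsum2 : ∀ k, Summable fun n => 2 * (c n * τ n ^ k) := fun k => (hsum k).mul_left 2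
  have hderiv : ∀ k t, iteratedDeriv k (fun t => ∑' n, u n t) t =
      ∑' n, c n * τ n ^ k * iteratedDeriv k cosAddSin (τ n * (t - b)) := by
    intro k t
    have h1 : iteratedFDeriv ℝ k (fun t => ∑' n, u n t) t = ∑' n, iteratedFDeriv ℝ k (u n) t :=
      iteratedFDeriv_tsum_apply (N := (⊤ : ℕ∞)) (v := fun k n => 2 * (c n * τ n ^ k)) hudiff
        (fun k _ => hsum2 k) (fun k n t _ => hbound k n t) le_top t
    have h2 : Summable fun n => iteratedFDeriv ℝ k (u n) t :=
      Summable.of_norm_bounded (hsum2 k) fun n => hbound k n t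
    rw [iteratedDeriv_eq_iteratedFDeriv, h1, ContinuousMultilinearMap.tsum_eval h2]
    exact tsum_congr fun n => iteratedDeriv_cosAddSin_affine (c n) (τ n) b k t
  refine ⟨fun t => ∑' n, u n t, contDiff_tsum (N := (⊤ : ℕ∞)) (v := fun k n => 2 * (c n * τ n ^ k)) hudiff
    (fun k _ => hsum2 k)
    (fun k n t _ => hbound k n t), fun k t => ?_, fun k => ?_⟩
  · rw [hderiv, ← tsum_mul_left, ← Real.norm_eq_abs]
    refine tsum_of_norm_bounded (hsum2 k).hasSum fun n => ?_
    rw [norm_mul, Real.norm_of_nonneg (hnn k n), mul_comm]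
    exact mul_le_mul_of_nonneg_right (abs_iteratedDeriv_cosAddSin_le k _) (hnn k n)
  · rw [hderiv]
    simp only [sub_self, mul_zero]
    rw [tsum_mul_right, abs_mul, abs_iteratedDeriv_cosAddSin_zero, mul_one,
      abs_of_nonneg (tsum_nonneg (hnn k))]

/-- A smooth function on the line gives a function on `ℝ^r` with values in `ℝ^s` whose derivatives
have the same norms. -/
lemma exists_norm_iteratedFDeriv_eq {r s : ℕ} (i : Fin r) (hs : 0 < s) {g : ℝ → ℝ}
    (hg : ContDiff ℝ ((⊤ : ℕ∞) : WithTop ℕ∞) g) :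
    ∃ F : Euc r → Euc s, ContDiff ℝ ((⊤ : ℕ∞) : WithTop ℕ∞) F ∧
      ∀ k x, ‖iteratedFDeriv ℝ k F x‖ = |iteratedDeriv k g (x i)| := by
  set w : Euc s := EuclideanSpace.single ⟨0, hs⟩ (1 : ℝ) with hw
  have hw1 : ‖w‖ = 1 := by simp [hw]
  let J : ℝ →ₗᵢ[ℝ] Euc s := LinearIsometry.toSpanSingleton ℝ (Euc s) hw1
  let L : Euc r →L[ℝ] ℝ := EuclideanSpace.proj i
  have hL : ∀ x : Euc r, L x = x i := fun x => rfl
  have hL1 : ‖L‖ ≤ 1 := ContinuousLinearMap.opNorm_le_bound _ zero_le_one fun x => by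
    rw [one_mul, hL]
    exact PiLp.norm_apply_le x i
  have hgL : ContDiff ℝ ((⊤ : ℕ∞) : WithTop ℕ∞) (g ∘ L) := hg.comp L.contDiff
  refine ⟨J ∘ (g ∘ L), J.toContinuousLinearMap.contDiff.comp hgL, fun k x => ?_⟩
  rw [J.norm_iteratedFDeriv_comp_left hgL.contDiffAt (mod_cast le_top),
    L.iteratedFDeriv_comp_right hg x (mod_cast le_top), hL, ← Real.norm_eq_abs]
  refine le_antisymm ?_ ?_
  · refine (ContinuousMultilinearMap.norm_compContinuousLinearMap_le _ _).trans ?_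
    rw [norm_iteratedFDeriv_eq_norm_iteratedDeriv]
    refine mul_le_of_le_one_right (norm_nonneg _) ?_
    exact Finset.prod_le_one (fun _ _ => norm_nonneg _) fun _ _ => hL1
  · set v : Euc r := EuclideanSpace.single i (1 : ℝ) with hv
    have h := ((iteratedFDeriv ℝ k g (x i)).compContinuousLinearMap fun _ => L).le_opNorm
      fun _ => v
    simpa [hv, hL, ← iteratedDeriv_eq_iteratedFDeriv] using h

/-- Coefficients and frequencies of a lacunary series which belongs to all classes given by the
log-convex sequences `A n` and reaches, up to a factor `2 ^ n`, the value `A n (j n)`. -/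
lemma exists_lacunary {A : ℕ → ℕ → ℝ} (hA : ∀ n k, 0 < A n k)
    (hlc : ∀ n k, A n (k + 1) ^ 2 ≤ A n k * A n (k + 2)) (hanti : ∀ k, Antitone fun n => A n k)
    (hfin : ∀ n (τ : ℝ), 0 < τ → ∃ C, ∀ k, τ ^ k ≤ C * A n k) (j : ℕ → ℕ) :
    ∃ c τ : ℕ → ℝ, (∀ n, 0 < c n) ∧ (∀ n, 0 < τ n) ∧
      (∀ m, ∃ E, 0 ≤ E ∧ ∀ n k, c n * τ n ^ k ≤ (1 / 2) ^ n * (E * A m k)) ∧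
      ∀ n, c n * τ n ^ j n = (1 / 2) ^ n * A n (j n) := by
  -- With this ratio the geometric progression supports `A n` at `j n`: the terms stay below `(1 /
  -- 2) ^ n * A n k`, with equality at `k = j n`.
  set τ : ℕ → ℝ := fun n => A n (j n + 1) / A n (j n) with hτ
  have hτ0 : ∀ n, 0 < τ n := fun n => div_pos (hA _ _) (hA _ _)
  set c : ℕ → ℝ := fun n => (1 / 2) ^ n * (A n (j n) / τ n ^ j n) with hc
  have hc0 : ∀ n, 0 < c n := fun n =>
    mul_pos (by positivity) (div_pos (hA _ _) (pow_pos (hτ0 n) _))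
  have hle : ∀ n k, c n * τ n ^ k ≤ (1 / 2) ^ n * A n k := by
    intro n k
    rw [hc, mul_assoc]
    refine mul_le_mul_of_nonneg_left ?_ (by positivity)
    rw [div_mul_eq_mul_div, div_le_iff₀ (pow_pos (hτ0 n) _), mul_comm, mul_comm (A n k)]
    exact logConvex_support (hA n) (hlc n) (j n) k
  refine ⟨c, τ, hc0, hτ0, fun m => ?_, fun n => ?_⟩
  -- For `n ≥ m` the sequence `A n` lies below `A m`; the finitely many `n < m` are absorbed into
  -- the constant through `hfin`.
  · choose C hC using fun n => hfin m (τ n) (hτ0 n)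
    have hC0 : ∀ n, 0 ≤ C n := fun n => by
      have h := hC n 0
      rw [pow_zero] at h
      by_contra hneg
      have := mul_neg_of_neg_of_pos (not_le.1 hneg) (hA m 0)
      linarith
    have hnn : ∀ n, 0 ≤ 2 ^ n * (c n * C n) := fun n =>
      mul_nonneg (by positivity) (mul_nonneg (hc0 n).le (hC0 n))
    have hS : 0 ≤ ∑ n ∈ Finset.range m, 2 ^ n * (c n * C n) := Finset.sum_nonneg fun n _ => hnn n
    refine ⟨1 + ∑ n ∈ Finset.range m, 2 ^ n * (c n * C n), by linarith, fun n k => ?_⟩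
    rcases lt_or_ge n m with h | h
    · have h1 : 2 ^ n * (c n * C n) ≤ 1 + ∑ n ∈ Finset.range m, 2 ^ n * (c n * C n) := by
        have := Finset.single_le_sum (fun i _ => hnn i) (Finset.mem_range.2 h)
        linarith
      calc c n * τ n ^ k ≤ c n * (C n * A m k) := mul_le_mul_of_nonneg_left (hC n k) (hc0 n).le
        _ = (1 / 2) ^ n * ((2 ^ n * (c n * C n)) * A m k) := by
          rw [one_div, inv_pow]; field_simp
        _ ≤ _ := by
          refine mul_le_mul_of_nonneg_left ?_ (by positivity)
          exact mul_le_mul_of_nonneg_right h1 (hA m k).le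
    · refine (hle n k).trans (mul_le_mul_of_nonneg_left ((hanti k h).trans ?_) (by positivity))
      exact le_mul_of_one_le_left (hA m k).le (by linarith)
  · rw [hc, mul_assoc, div_mul_cancel₀ _ (pow_pos (hτ0 n) _).ne']

/-- If every smooth function on `U` obeying all the bounds `A n` obeys, at each point, one of the
bounds `a n`, then some `A n` is dominated by `a n`. -/
theorem exists_le_of_forall_smooth {r s : ℕ} (hr : 0 < r) (hs : 0 < s) {U : Set (Euc r)}
    (hU : IsOpen U) (hU' : U.Nonempty) {A a : ℕ → ℕ → ℝ} (hA : ∀ n k, 0 < A n k)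
    (hlc : ∀ n k, A n (k + 1) ^ 2 ≤ A n k * A n (k + 2)) (hanti : ∀ k, Antitone fun n => A n k)
    (hfin : ∀ n (τ : ℝ), 0 < τ → ∃ C, ∀ k, τ ^ k ≤ C * A n k)
    (ha : ∀ n k, 0 < a n k) (hmono : ∀ k, Monotone fun n => a n k)
    (h : ∀ f ∈ smoothFun s U,
      (∀ n, ∃ C, ∀ k, ∀ x ∈ U, ‖iteratedFDeriv ℝ k f x‖ ≤ C * A n k) →
      ∀ x ∈ U, ∃ n C, ∀ k, ‖iteratedFDeriv ℝ k f x‖ ≤ C * a n k) :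
    ∃ n, ∀ k, A n k ≤ 4 ^ n * a n k := by
  -- Each `n` then has an index `j n` with `A n (j n) > 4 ^ n * a n (j n)`. The lacunary series
  -- reaches at `x₀` at least `(1 / 2) ^ n` times this, so `2 ^ n * a n (j n)`, more than any fixed
  -- bound `C * a m` allows.
  by_contra! hcon
  choose j hj using hcon
  obtain ⟨x₀, hx₀⟩ := hU'
  obtain ⟨c, τ, hc, hτ, hbd, hval⟩ := exists_lacunary hA hlc hanti hfin j
  have hgeo : Summable fun n : ℕ => ((1 : ℝ) / 2) ^ n := summable_geometric_two
  have hnn : ∀ k n, 0 ≤ c n * τ n ^ k := fun k n => mul_nonneg (hc n).le (pow_nonneg (hτ n).le k)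
  have hsum : ∀ k, Summable fun n => c n * τ n ^ k := by
    intro k
    obtain ⟨E, -, hE⟩ := hbd 0
    exact Summable.of_nonneg_of_le (hnn k) (fun n => hE n k) (hgeo.mul_right _)
  obtain ⟨g, hg, hgle, hgb⟩ := exists_trigSeries (fun n => (hc n).le) (fun n => (hτ n).le) hsum
    (x₀ ⟨0, hr⟩)
  obtain ⟨F, hF, hFn⟩ := exists_norm_iteratedFDeriv_eq (r := r) ⟨0, hr⟩ hs hg
  have heq : ∀ x ∈ U, ∀ k, iteratedFDeriv ℝ k (U.indicator F) x = iteratedFDeriv ℝ k F x := by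
    intro x hx k
    have h1 : U.indicator F =ᶠ[𝓝 x] F := by
      filter_upwards [hU.mem_nhds hx] with y hy
      exact Set.indicator_of_mem hy F
    exact (h1.iteratedFDeriv ℝ k).eq_of_nhds
  have hmem : U.indicator F ∈ smoothFun s U :=
    ⟨hF.contDiffOn.congr fun x hx => Set.indicator_of_mem hx F,
      fun x hx => Set.indicator_of_notMem hx F⟩
  obtain ⟨m, C, hC⟩ := h _ hmem (fun n => by
    obtain ⟨E, -, hE⟩ := hbd n
    -- One factor `2` bounds the derivatives of `cosAddSin`, the other is the sum of the geometric
    -- series.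
    refine ⟨4 * E, fun k x hx => ?_⟩
    rw [heq x hx, hFn]
    refine (hgle k _).trans ?_
    have h1 : ∑' i, c i * τ i ^ k ≤ ∑' i : ℕ, ((1 : ℝ) / 2) ^ i * (E * A n k) :=
      (hsum k).tsum_le_tsum (fun i => hE i k) (hgeo.mul_right _)
    rw [tsum_mul_right, tsum_geometric_two] at h1
    linarith) x₀ hx₀
  obtain ⟨n, hn⟩ := pow_unbounded_of_one_lt C (one_lt_two (α := ℝ))
  set p := max n m with hp
  have h1 := hC (j p)
  rw [heq x₀ hx₀, hFn, hgb] at h1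
  have h2 : c p * τ p ^ j p ≤ ∑' i, c i * τ i ^ j p := (hsum _).le_tsum p fun i _ => hnn _ i
  rw [hval] at h2
  have h3 : C ≤ 2 ^ p := hn.le.trans (pow_le_pow_right₀ one_le_two (le_max_left _ _))
  have h4 : C * a m (j p) ≤ 2 ^ p * a p (j p) :=
    (mul_le_mul_of_nonneg_right h3 (ha _ _).le).trans
      (mul_le_mul_of_nonneg_left (hmono _ (le_max_right n m)) (by positivity))
  have h5 : (1 / 2 : ℝ) ^ p * (4 ^ p * a p (j p)) < (1 / 2) ^ p * A p (j p) :=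
    mul_lt_mul_of_pos_left (hj p) (by positivity)
  have h6 : (1 / 2 : ℝ) ^ p * (4 ^ p * a p (j p)) = 2 ^ p * a p (j p) := by
    rw [← mul_assoc, ← mul_pow]
    norm_num
  linarith

end Series

/-! ### Comparison of classes -/

section Classes

variable {r s : ℕ}

lemma wnorm_lt_top_iff {a : ℕ → ℝ} (ha : ∀ k, 0 < a k) {K : Set (Euc r)} {f : Euc r → Euc s} :
    wnorm a K f < ⊤ ↔ ∃ C : ℝ, ∀ k, ∀ x ∈ K, ‖iteratedFDeriv ℝ k f x‖ ≤ C * a k := by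
  constructor
  · intro h
    refine ⟨(wnorm a K f).toReal, fun k x hx => ?_⟩
    rw [← div_le_iff₀ (ha k)]
    refine (ENNReal.ofReal_le_iff_le_toReal h.ne).1 ?_
    exact le_iSup_of_le k (le_iSup₂_of_le x hx le_rfl)
  · rintro ⟨C, hC⟩
    refine lt_of_le_of_lt (b := ENNReal.ofReal C) ?_ ENNReal.ofReal_lt_top
    refine iSup_le fun k => iSup₂_le fun x hx => ENNReal.ofReal_le_ofReal ?_
    rw [div_le_iff₀ (ha k)]
    exact hC k x hx

lemma wnorm_le_mul {a b : ℕ → ℝ} (ha : ∀ k, 0 < a k) (hb : ∀ k, 0 < b k) {C : ℝ} (hC : 0 ≤ C)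
    (h : ∀ k, a k ≤ C * b k) (K : Set (Euc r)) (f : Euc r → Euc s) :
    wnorm b K f ≤ ENNReal.ofReal C * wnorm a K f := by
  refine iSup_le fun k => iSup₂_le fun x hx => ?_
  have h1 : ‖iteratedFDeriv ℝ k f x‖ / b k ≤ C * (‖iteratedFDeriv ℝ k f x‖ / a k) := by
    rw [← mul_div_assoc, div_le_div_iff₀ (hb k) (ha k)]
    have := mul_le_mul_of_nonneg_left (h k) (norm_nonneg (iteratedFDeriv ℝ k f x))
    linarith
  refine (ENNReal.ofReal_le_ofReal h1).trans ?_
  rw [ENNReal.ofReal_mul hC]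
  gcongr
  exact le_iSup_of_le k (le_iSup₂_of_le x hx le_rfl)

/-- Domination of families of weights which gives continuous inclusion of the classes. -/
def ScaleLe (A B : ℝ → ℕ → ℝ) : ClassType → Prop
  | .roumieu => ∀ h : ℝ, 0 < h → ∃ h' : ℝ, 0 < h' ∧ ∃ C : ℝ, 0 < C ∧ ∀ k, A h k ≤ C * B h' k
  | .beurling => ∀ h' : ℝ, 0 < h' → ∃ h : ℝ, 0 < h ∧ ∃ C : ℝ, 0 < C ∧ ∀ k, A h k ≤ C * B h' k

variable {A B : ℝ → ℕ → ℝ} {ty : ClassType}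

lemma wnorm_lt_top_of_le {a b : ℕ → ℝ} (ha : ∀ k, 0 < a k) (hb : ∀ k, 0 < b k) {C : ℝ}
    (hC : 0 ≤ C) (h : ∀ k, a k ≤ C * b k) {K : Set (Euc r)} {f : Euc r → Euc s}
    (hf : wnorm a K f < ⊤) : wnorm b K f < ⊤ :=
  (wnorm_le_mul ha hb hC h K f).trans_lt (ENNReal.mul_lt_top ENNReal.ofReal_lt_top hf)

lemma ScaleLe.ultraClass_subset (hA : ∀ h, 0 < h → ∀ k, 0 < A h k)
    (hB : ∀ h, 0 < h → ∀ k, 0 < B h k) (h : ScaleLe A B ty) (s : ℕ) (U : Set (Euc r)) :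
    ultraClass s U A ty ⊆ ultraClass s U B ty := by
  cases ty with
  | roumieu =>
    rintro f ⟨hf, hfK⟩
    refine ⟨hf, fun K hK hKU => ?_⟩
    obtain ⟨l, hl, hfl⟩ := hfK K hK hKU
    obtain ⟨l', hl', C, hC, hle⟩ := h l hl
    exact ⟨l', hl', wnorm_lt_top_of_le (hA l hl) (hB l' hl') hC.le hle hfl⟩
  | beurling =>
    rintro f ⟨hf, hfK⟩
    refine ⟨hf, fun K hK hKU l' hl' => ?_⟩
    obtain ⟨l, hl, C, hC, hle⟩ := h l' hl'
    exact wnorm_lt_top_of_le (hA l hl) (hB l' hl') hC.le hle (hfK K hK hKU l hl)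

lemma mul_toReal_wnorm_le {a b : ℕ → ℝ} (ha : ∀ k, 0 < a k) (hb : ∀ k, 0 < b k) {C : ℝ}
    (hC : 0 ≤ C) (h : ∀ k, a k ≤ C * b k) {K : Set (Euc r)} {f : Euc r → Euc s}
    (hf : wnorm a K f < ⊤) (D : ℝ) :
    D * (wnorm b K f).toReal ≤ |D| * C * (wnorm a K f).toReal := by
  have h1 := ENNReal.toReal_mono (ENNReal.mul_lt_top ENNReal.ofReal_lt_top hf).ne
    (wnorm_le_mul ha hb hC h K f)
  rw [ENNReal.toReal_mul, ENNReal.toReal_ofReal hC] at h1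
  calc D * (wnorm b K f).toReal ≤ |D| * (wnorm b K f).toReal :=
        mul_le_mul_of_nonneg_right (le_abs_self D) ENNReal.toReal_nonneg
    _ ≤ |D| * (C * (wnorm a K f).toReal) := mul_le_mul_of_nonneg_left h1 (abs_nonneg D)
    _ = _ := (mul_assoc _ _ _).symm

/-- The step spaces of `A` embed continuously into those of `B`, so continuous seminorms pull back
in the opposite direction. -/
lemma ScaleLe.isContSeminorm (hA : ∀ h, 0 < h → ∀ k, 0 < A h k)
    (hB : ∀ h, 0 < h → ∀ k, 0 < B h k) (h : ScaleLe A B ty) {V : Set (Euc r)}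
    {p : Seminorm ℝ (Euc r → Euc s)} (hp : IsContSeminorm V B p ty) :
    IsContSeminorm V A p ty := by
  cases ty with
  | roumieu =>
    intro l hl
    obtain ⟨l', hl', C, hC, hle⟩ := h l hl
    obtain ⟨D, hD⟩ := hp l' hl'
    refine ⟨|D| * C, fun f hf => (hD f ⟨hf.1, ?_⟩).trans ?_⟩
    · exact wnorm_lt_top_of_le (hA l hl) (hB l' hl') hC.le hle hf.2
    · exact mul_toReal_wnorm_le (hA l hl) (hB l' hl') hC.le hle hf.2 D
  | beurling =>
    obtain ⟨l', hl', D, hD⟩ := hp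
    obtain ⟨l, hl, C, hC, hle⟩ := h l' hl'
    refine ⟨l, hl, |D| * C, fun f hf => (hD f fun m' hm' => ?_).trans ?_⟩
    · obtain ⟨m, hm, E, hE, hmle⟩ := h m' hm'
      exact ⟨(hf m hm).1, wnorm_lt_top_of_le (hA m hm) (hB m' hm') hE.le hmle (hf m hm).2⟩
    · exact mul_toReal_wnorm_le (hA l hl) (hB l' hl') hC.le hle (hf l hl).2 D

/-- The topology on a set `X` of functions generated by the balls of the seminorms
`f ↦ p (f restricted to V)` with `P V p`. -/
@[reducible] def seminormTopology (s : ℕ) (U : Set (Euc r)) (X : Set (Euc r → Euc s))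
    (P : Set (Euc r) → Seminorm ℝ (Euc r → Euc s) → Prop) : TopologicalSpace X :=
  TopologicalSpace.generateFrom
    {S | ∃ V : Set (Euc r), IsOpen V ∧ IsCompact (closure V) ∧ closure V ⊆ U ∧
      ∃ p : Seminorm ℝ (Euc r → Euc s), P V p ∧
      ∃ g ∈ X, ∃ ε : ℝ, 0 < ε ∧ S = Subtype.val ⁻¹' (p.comp (restrictTo s V)).ball g ε}

lemma isOpen_seminormTopology_congr {U : Set (Euc r)} {X Y : Set (Euc r → Euc s)}
    {P Q : Set (Euc r) → Seminorm ℝ (Euc r → Euc s) → Prop} (hXY : X = Y) (hPQ : P = Q)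
    (S : Set (Euc r → Euc s)) :
    IsOpen[seminormTopology s U X P] (Subtype.val ⁻¹' S) ↔
      IsOpen[seminormTopology s U Y Q] (Subtype.val ⁻¹' S) := by
  subst hXY hPQ
  rfl

/-- Mutual domination gives the same functions and the same continuous seminorms on each `V`, hence
the same generating sets for the topology. -/
theorem eqLCS_of_scaleLe (hA : ∀ h, 0 < h → ∀ k, 0 < A h k) (hB : ∀ h, 0 < h → ∀ k, 0 < B h k)
    (h₁ : ScaleLe A B ty) (h₂ : ScaleLe B A ty) (s : ℕ) (U : Set (Euc r)) :
    EqLCS s U A B ty := by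
  have hcl : ultraClass s U A ty = ultraClass s U B ty :=
    (h₁.ultraClass_subset hA hB s U).antisymm (h₂.ultraClass_subset hB hA s U)
  refine ⟨hcl, isOpen_seminormTopology_congr (P := fun V p => IsContSeminorm V A p ty)
    (Q := fun V p => IsContSeminorm V B p ty) hcl ?_⟩
  funext V p
  exact propext ⟨h₂.isContSeminorm hB hA, h₁.isContSeminorm hA hB⟩

lemma SameClass.symm (h : SameClass ty A B) : SameClass ty B A := fun r s hr hs U hU hU' =>
  ⟨(h r s hr hs U hU hU').1.symm, fun S => ((h r s hr hs U hU hU').2 S).symm⟩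

end Classes

/-! ### Weights from `ω` against weights from a sequence -/

section Scales

variable {ω : ℝ → ℝ} {N : ℕ → ℝ}

lemma seqScale_pos (hN : IsLC N) (h : ℝ) (hh : 0 < h) (k : ℕ) : 0 < seqScale N h k :=
  mul_pos (pow_pos hh k) (hN.pos k)

lemma funScale_eq (ω : ℝ → ℝ) : funScale ω = assocMatrix ω := rfl

/-- In the Roumieu case (ω₁) absorbs `(t * B) ^ k` by enlarging `l`, the maximum with `1` serving
only that absorption. In the Beurling case `h = 1 / B` cancels the geometric factor. -/
lemma scaleLe_seqScale_funScale (hω : IsW ω)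
    (h : ∀ l, 0 < l → SeqLe N (assocMatrix ω l)) (ty : ClassType) :
    ScaleLe (seqScale N) (assocMatrix ω) ty := by
  cases ty with
  | roumieu =>
    intro t ht
    obtain ⟨B, K, hB, hK, hle⟩ := h 1 one_pos
    obtain ⟨L, hL, hLe⟩ := hω.exists_pow_mul_assocMatrix_le (le_max_right (t * B) 1)
    obtain ⟨C, hC, hCle⟩ := hLe 1 one_pos
    refine ⟨L * 1, by linarith, K * C, by positivity, fun k => ?_⟩
    have hpos := assocMatrix_pos (ω := ω) 1 k
    calc t ^ k * N k ≤ t ^ k * (K * B ^ k * assocMatrix ω 1 k) :=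
          mul_le_mul_of_nonneg_left (hle k) (by positivity)
      _ = K * ((t * B) ^ k * assocMatrix ω 1 k) := by rw [mul_pow]; ring
      _ ≤ K * (max (t * B) 1 ^ k * assocMatrix ω 1 k) := by
        have := le_max_left (t * B) 1
        gcongr
      _ ≤ K * (C * assocMatrix ω (L * 1) k) := mul_le_mul_of_nonneg_left (hCle k) (by linarith)
      _ = _ := by ring
  | beurling =>
    intro l hl
    obtain ⟨B, K, hB, hK, hle⟩ := h l hl
    refine ⟨1 / B, by positivity, K, by linarith, fun k => ?_⟩
    calc (1 / B) ^ k * N k ≤ (1 / B) ^ k * (K * B ^ k * assocMatrix ω l k) :=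
          mul_le_mul_of_nonneg_left (hle k) (by positivity)
      _ = K * assocMatrix ω l k := by
        rw [one_div, inv_pow]; field_simp

lemma scaleLe_funScale_seqScale (hω : IsW ω) (hN : IsLC N)
    (h : ∀ l, 0 < l → SeqLe (assocMatrix ω l) N) (ty : ClassType) :
    ScaleLe (assocMatrix ω) (seqScale N) ty := by
  cases ty with
  | roumieu =>
    intro l hl
    obtain ⟨B, K, hB, hK, hle⟩ := h l hl
    refine ⟨B, by linarith, K, by linarith, fun k => (hle k).trans (le_of_eq ?_)⟩
    rw [seqScale, mul_assoc]
  | beurling =>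
    intro t ht
    obtain ⟨B, K, hB, hK, hle⟩ := h 1 one_pos
    set H := max (B / t) 1 with hH
    have hH0 : 0 < H := lt_max_of_lt_right one_pos
    obtain ⟨L, hL, hLe⟩ := hω.exists_pow_mul_assocMatrix_le (le_max_right (B / t) 1)
    -- The parameter `1 / L` makes the absorption end at parameter `1`, where `hle` is available.
    obtain ⟨C, hC, hCle⟩ := hLe (1 / L) (by positivity)
    rw [mul_one_div_cancel (by positivity)] at hCle
    refine ⟨1 / L, by positivity, C * K, by positivity, fun k => ?_⟩
    have hNk := hN.pos k
    have h1 : B ≤ H * t := (div_le_iff₀ ht).1 (le_max_left _ _)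
    refine le_of_mul_le_mul_left (a := H ^ k) ?_ (by positivity)
    calc H ^ k * assocMatrix ω (1 / L) k ≤ C * assocMatrix ω 1 k := hCle k
      _ ≤ C * (K * B ^ k * N k) := mul_le_mul_of_nonneg_left (hle k) hC.le
      _ ≤ C * (K * (H * t) ^ k * N k) := by gcongr
      _ = H ^ k * (C * K * seqScale N t k) := by rw [seqScale, mul_pow]; ring

/-- The classes given by `ω` and by a sequence equivalent to all members of its matrix agree. -/
theorem sameClass_funScale_seqScale (hω : IsW ω) (hN : IsLC N)
    (h : ∀ l, 0 < l → SeqEquiv N (assocMatrix ω l)) (ty : ClassType) :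
    SameClass ty (funScale ω) (seqScale N) := fun _ s _ _ U _ _ =>
  eqLCS_of_scaleLe (fun l _ => assocMatrix_pos l) (seqScale_pos hN)
    (scaleLe_funScale_seqScale hω hN (fun l hl => (h l hl).2) ty)
    (scaleLe_seqScale_funScale hω (fun l hl => (h l hl).1) ty) s U

/-- Under moderate growth and (β₃), `N` is equivalent to every member of the matrix of `ω_N`. -/
lemma IsLC.seqEquiv_assocMatrix_assocFun (hN : IsLC N) (hmg : HasMg N) {l : ℝ} (hl : 0 < l) :
    SeqEquiv N (assocMatrix (assocFun N) l) := by
  refine hN.isW0_assocFun.seqEquiv_assocMatrix hN hmg one_pos ?_ hl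
  rw [show assocMatrix (assocFun N) 1 = N from funext hN.assocMatrix_assocFun_one]
  exact ⟨⟨1, 1, le_rfl, le_rfl, fun p => by simp⟩, ⟨1, 1, le_rfl, le_rfl, fun p => by simp⟩⟩

end Scales

/-! ### From equality of classes to relations between the weights -/

section Converse

variable {r s : ℕ} {U : Set (Euc r)} {ω : ℝ → ℝ} {N : ℕ → ℝ}

lemma IsLC.exists_pow_le (hN : IsLC N) {τ : ℝ} (hτ : 0 < τ) : ∃ C : ℝ, ∀ k, τ ^ k ≤ C * N k := by
  refine ⟨Real.exp (assocFun N τ), fun k => ?_⟩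
  rw [← Real.log_le_log_iff (pow_pos hτ k) (mul_pos (Real.exp_pos _) (hN.pos k)), Real.log_pow,
    Real.log_mul (Real.exp_pos _).ne' (hN.pos k).ne', Real.log_exp]
  linarith [hN.le_assocFun hτ k]

lemma IsLC.seqScale_logConvex (hN : IsLC N) (h : ℝ) (k : ℕ) :
    seqScale N h (k + 1) ^ 2 ≤ seqScale N h k * seqScale N h (k + 2) := by
  have h1 := mul_le_mul_of_nonneg_left (hN.logConvex k) (sq_nonneg (h ^ (k + 1)))
  calc seqScale N h (k + 1) ^ 2 = (h ^ (k + 1)) ^ 2 * N (k + 1) ^ 2 := by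
        rw [seqScale]; ring
    _ ≤ _ := h1
    _ = _ := by rw [seqScale, seqScale]; ring

lemma IsLC.exists_pow_le_seqScale (hN : IsLC N) {h τ : ℝ} (hh : 0 < h) (hτ : 0 < τ) :
    ∃ C : ℝ, ∀ k, τ ^ k ≤ C * seqScale N h k := by
  obtain ⟨C, hC⟩ := hN.exists_pow_le (div_pos hτ hh)
  refine ⟨C, fun k => ?_⟩
  have h1 := mul_le_mul_of_nonneg_left (hC k) (pow_pos hh k).le
  rw [← mul_pow, mul_div_cancel₀ _ hh.ne'] at h1
  refine h1.trans (le_of_eq ?_)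
  rw [seqScale]
  ring

lemma IsLC.seqScale_mono (hN : IsLC N) {h h' : ℝ} (hh : 0 ≤ h) (hle : h ≤ h') (k : ℕ) :
    seqScale N h k ≤ seqScale N h' k :=
  mul_le_mul_of_nonneg_right (pow_le_pow_left₀ hh hle k) (hN.pos k).le

variable {A B : ℝ → ℕ → ℝ}

/-- Inclusion of Roumieu classes: every weight of the smaller class is dominated by one of the
larger class. -/
lemma exists_le_of_roumieu_subset (hr : 0 < r) (hs : 0 < s) (hU : IsOpen U) (hU' : U.Nonempty)
    {a : ℕ → ℝ} {h₀ : ℝ} (hh₀ : 0 < h₀) (hAa : A h₀ = a) (ha : ∀ k, 0 < a k)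
    (hlc : ∀ k, a (k + 1) ^ 2 ≤ a k * a (k + 2))
    (hfin : ∀ τ : ℝ, 0 < τ → ∃ C, ∀ k, τ ^ k ≤ C * a k)
    (hB : ∀ h, 0 < h → ∀ k, 0 < B h k)
    (hBm : ∀ h h' : ℝ, 0 < h → h ≤ h' → ∀ k, B h k ≤ B h' k)
    (hsub : ultraClass s U A .roumieu ⊆ ultraClass s U B .roumieu) :
    ∃ h : ℝ, 0 < h ∧ ∃ C : ℝ, 1 ≤ C ∧ ∀ k, a k ≤ C * B h k := by
  have hn1 : ∀ n : ℕ, (0 : ℝ) < n + 1 := fun n => by positivity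
  -- The upper weights are constant in `n`; the parameters `n + 1` are cofinal among all `h > 0`.
  obtain ⟨n, hn⟩ := exists_le_of_forall_smooth hr hs hU hU' (A := fun _ => a)
    (a := fun n => B (n + 1)) (fun _ => ha) (fun _ => hlc) (fun k => antitone_const)
    (fun _ => hfin) (fun n => hB _ (hn1 n)) (fun k m n hmn => hBm _ _ (hn1 m)
      (by simpa using hmn) k) fun f hf hbd x hx => by
    have hfA : f ∈ ultraClass s U A .roumieu := by
      refine ⟨hf, fun K _ hKU => ⟨h₀, hh₀, ?_⟩⟩
      rw [hAa]
      obtain ⟨C, hC⟩ := hbd 0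
      exact (wnorm_lt_top_iff ha).2 ⟨C, fun k x hx => hC k x (hKU hx)⟩
    obtain ⟨l, hl, hfl⟩ := (hsub hfA).2 {x} isCompact_singleton (Set.singleton_subset_iff.2 hx)
    obtain ⟨n, hn⟩ := exists_nat_ge l
    have hfn := wnorm_lt_top_of_le (hB l hl) (hB _ (hn1 n)) zero_le_one
      (fun k => by simpa using hBm l (n + 1) hl (by linarith) k) hfl
    obtain ⟨C, hC⟩ := (wnorm_lt_top_iff (hB _ (hn1 n))).1 hfn
    exact ⟨n, C, fun k => hC k x rfl⟩
  exact ⟨n + 1, hn1 n, 4 ^ n, one_le_pow₀ (by norm_num), hn⟩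

/-- Inclusion of Beurling classes: every weight of the larger class dominates one of the smaller
class. -/
lemma exists_le_of_beurling_subset (hr : 0 < r) (hs : 0 < s) (hU : IsOpen U) (hU' : U.Nonempty)
    {b : ℕ → ℝ} {h₀ : ℝ} (hh₀ : 0 < h₀) (hBb : B h₀ = b) (hb : ∀ k, 0 < b k)
    (hA : ∀ h, 0 < h → ∀ k, 0 < A h k)
    (hlc : ∀ h, 0 < h → ∀ k, A h (k + 1) ^ 2 ≤ A h k * A h (k + 2))
    (hfin : ∀ h : ℝ, 0 < h → ∀ τ : ℝ, 0 < τ → ∃ C, ∀ k, τ ^ k ≤ C * A h k)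
    (hAm : ∀ h h' : ℝ, 0 < h → h ≤ h' → ∀ k, A h k ≤ A h' k)
    (hsub : ultraClass s U A .beurling ⊆ ultraClass s U B .beurling) :
    ∃ h : ℝ, 0 < h ∧ ∃ C : ℝ, 1 ≤ C ∧ ∀ k, A h k ≤ C * b k := by
  have hn1 : ∀ n : ℕ, (0 : ℝ) < 1 / (n + 1) := fun n => by positivity
  -- Here the parameters `1 / (n + 1)` decrease to `0`, and the target weight is constant.
  obtain ⟨n, hn⟩ := exists_le_of_forall_smooth hr hs hU hU' (A := fun n => A (1 / (n + 1)))
    (a := fun _ => b) (fun n => hA _ (hn1 n)) (fun n => hlc _ (hn1 n))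
    (fun k m n hmn => hAm _ _ (hn1 n) (Nat.one_div_le_one_div hmn) k)
    (fun n => hfin _ (hn1 n)) (fun _ => hb) (fun k => monotone_const) fun f hf hbd x hx => by
    have hfA : f ∈ ultraClass s U A .beurling := by
      refine ⟨hf, fun K _ hKU h hh => ?_⟩
      obtain ⟨n, hn⟩ := exists_nat_one_div_lt hh
      obtain ⟨C, hC⟩ := hbd n
      have h1 : wnorm (A (1 / (n + 1))) K f < ⊤ :=
        (wnorm_lt_top_iff (hA _ (hn1 n))).2 ⟨C, fun k x hx => hC k x (hKU hx)⟩
      exact wnorm_lt_top_of_le (hA _ (hn1 n)) (hA h hh) zero_le_one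
        (fun k => by simpa using hAm _ h (hn1 n) hn.le k) h1
    have h2 := (hsub hfA).2 {x} isCompact_singleton (Set.singleton_subset_iff.2 hx) h₀ hh₀
    rw [hBb] at h2
    obtain ⟨C, hC⟩ := (wnorm_lt_top_iff hb).1 h2
    exact ⟨0, C, fun k => hC k x rfl⟩
  exact ⟨1 / (n + 1), hn1 n, 4 ^ n, one_le_pow₀ (by norm_num), hn⟩

lemma seqLe_of_le_mul_seqScale {M : ℕ → ℝ} (hN : IsLC N) {h C : ℝ} (hC : 1 ≤ C)
    (hle : ∀ k, M k ≤ C * seqScale N h k) (hh : 0 < h) : SeqLe M N := by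
  refine ⟨max h 1, C, le_max_right _ _, hC, fun k => (hle k).trans ?_⟩
  rw [mul_assoc]
  exact mul_le_mul_of_nonneg_left (hN.seqScale_mono hh.le (le_max_left _ _) k) (by linarith)

lemma seqLe_of_seqScale_le_mul {M : ℕ → ℝ} (hM : ∀ k, 0 < M k) {h C : ℝ} (hC : 1 ≤ C)
    (hle : ∀ k, seqScale N h k ≤ C * M k) (hh : 0 < h) : SeqLe N M := by
  refine ⟨max (1 / h) 1, C, le_max_right _ _, hC, fun k => ?_⟩
  have h1 := mul_le_mul_of_nonneg_left (hle k) (pow_pos (one_div_pos.2 hh) k).le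
  rw [seqScale, ← mul_assoc, ← mul_pow, one_div_mul_cancel hh.ne', one_pow, one_mul] at h1
  have hMk := hM k
  calc N k ≤ (1 / h) ^ k * (C * M k) := h1
    _ ≤ max (1 / h) 1 ^ k * (C * M k) := by
      have := le_max_left (1 / h) 1
      gcongr
    _ = _ := by ring

/-- If the classes given by `ω` and `N` agree, then `N` is squeezed between two members of the
matrix associated with `ω`. -/
theorem exists_seqLe_of_ultraClass_eq {ty : ClassType} (hr : 0 < r) (hs : 0 < s) (hU : IsOpen U)
    (hU' : U.Nonempty) (hN : IsLC N) (hω : IsW0 ω)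
    (heq : ultraClass s U (funScale ω) ty = ultraClass s U (seqScale N) ty) :
    ∃ l : ℝ, 0 < l ∧ SeqLe N (assocMatrix ω l) ∧ SeqLe (assocMatrix ω (2 * l)) N := by
  have hLC : ∀ l : ℝ, 0 < l → IsLC (assocMatrix ω l) := fun l hl => hω.isLC_assocMatrix hl
  rw [funScale_eq] at heq
  cases ty with
  | roumieu =>
    obtain ⟨l, hl, C, hC, hle⟩ := exists_le_of_roumieu_subset hr hs hU hU' (A := seqScale N)
      (B := assocMatrix ω) one_pos (by ext k; simp [seqScale]) hN.pos hN.logConvex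
      (fun τ hτ => hN.exists_pow_le hτ) (fun l _ => assocMatrix_pos l)
      (fun l l' hl hll => hω.assocMatrix_mono hl hll) heq.ge
    -- The second inclusion applies to any parameter, so it is used at twice the `l` found by the
    -- first, as `hasMg_of_seqLe` requires; the Beurling case uses `l / 2` in the same way.
    have h2l : 0 < 2 * l := by positivity
    obtain ⟨h, hh, D, hD, hle'⟩ := exists_le_of_roumieu_subset hr hs hU hU' (A := assocMatrix ω)
      (B := seqScale N) h2l rfl (hLC _ h2l).pos (hLC _ h2l).logConvex
      (fun τ hτ => (hLC _ h2l).exists_pow_le hτ) (seqScale_pos hN)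
      (fun h h' hh hle => hN.seqScale_mono hh.le hle) heq.le
    exact ⟨l, hl, ⟨1, C, le_rfl, hC, by simpa using hle⟩, seqLe_of_le_mul_seqScale hN hD hle' hh⟩
  | beurling =>
    obtain ⟨l, hl, C, hC, hle⟩ := exists_le_of_beurling_subset hr hs hU hU' (A := assocMatrix ω)
      (B := seqScale N) one_pos (by ext k; simp [seqScale]) hN.pos (fun l _ => assocMatrix_pos l)
      (fun l hl => (hLC l hl).logConvex) (fun l hl τ hτ => (hLC l hl).exists_pow_le hτ)
      (fun l l' hl hll => hω.assocMatrix_mono hl hll) heq.le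
    have hl2 : 0 < l / 2 := half_pos hl
    obtain ⟨h, hh, D, hD, hle'⟩ := exists_le_of_beurling_subset hr hs hU hU' (A := seqScale N)
      (B := assocMatrix ω) hl2 rfl (hLC _ hl2).pos (seqScale_pos hN)
      (fun h _ => hN.seqScale_logConvex h) (fun h hh τ hτ => hN.exists_pow_le_seqScale hh hτ)
      (fun h h' hh hle => hN.seqScale_mono hh.le hle) heq.ge
    refine ⟨l / 2, hl2, seqLe_of_seqScale_le_mul (hLC _ hl2).pos hD hle' hh, ?_⟩
    rw [mul_div_cancel₀ l two_ne_zero]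
    exact ⟨1, C, le_rfl, hC, by simpa using hle⟩

/-- If the classes given by `ω` and `N` agree, then `N` has moderate growth and is equivalent to
all members of the matrix associated with `ω`. -/
theorem hasMg_and_seqEquiv_of_ultraClass_eq {ty : ClassType} (hr : 0 < r) (hs : 0 < s)
    (hU : IsOpen U) (hU' : U.Nonempty) (hN : IsLC N) (hω : IsW0 ω)
    (heq : ultraClass s U (funScale ω) ty = ultraClass s U (seqScale N) ty) :
    HasMg N ∧ ∀ l : ℝ, 0 < l → SeqEquiv N (assocMatrix ω l) := by
  obtain ⟨l₀, hl₀, h₁, h₂⟩ := exists_seqLe_of_ultraClass_eq hr hs hU hU' hN hω heq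
  have hmg := hω.hasMg_of_seqLe hN hl₀ h₁ h₂
  refine ⟨hmg, fun l hl => hω.seqEquiv_assocMatrix hN hmg hl₀ ⟨h₁, SeqLe.trans ?_ h₂⟩ hl⟩
  exact ⟨1, 1, le_rfl, le_rfl, fun p => by
    simpa using hω.assocMatrix_mono hl₀ (l' := 2 * l₀) (by linarith) p⟩

end Converse

end Ultradiff

/-! ### The main theorem -/

open Ultradiff
theorem mainTheorem8 (ty : ClassType) (r s : ℕ) (hr : 0 < r) (hs : 0 < s)
    (U : Set (Euc r)) (hU : IsOpen U) (hU' : U.Nonempty)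
    (N : ℕ → ℝ) (hN : IsLC N) (hβ : HasBeta3 N) :
    List.TFAE
      [∃ ω : ℝ → ℝ, IsW ω ∧ ultraClass s U (funScale ω) ty = ultraClass s U (seqScale N) ty,
       HasMg N,
       ultraClass s U (funScale (assocFun N)) ty = ultraClass s U (seqScale N) ty] ∧
    ∀ ω : ℝ → ℝ, IsW ω →
      ultraClass s U (funScale ω) ty = ultraClass s U (seqScale N) ty →
      -- (a)
      (IsW (assocFun N) ∧ Om6 ω ∧ Om6 (assocFun N) ∧
        ∀ l : ℝ, 0 < l → IsW (assocFun (assocMatrix ω l)) ∧ Om6 (assocFun (assocMatrix ω l))) ∧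
      -- (b)
      (FunEquiv ω (assocFun N) ∧
        ∀ l : ℝ, 0 < l → FunEquiv (assocFun (assocMatrix ω l)) ω) ∧
      -- (c)
      (SameClass ty (funScale (assocFun N)) (seqScale N) ∧
        SameClass ty (seqScale N) (funScale ω) ∧
        ∀ l : ℝ, 0 < l → SameClass ty (funScale ω) (seqScale (assocMatrix ω l))) ∧
      -- (d)
      (∀ l : ℝ, 0 < l → SeqEquiv N (assocMatrix ω l)) ∧
      -- (e)
      (∀ l : ℝ, 0 < l → HasMg (assocMatrix ω l)) ∧
      -- (f), first part
      (LiminfPos N →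
        (Om2 ω ∧ Om2 (assocFun N) ∧ ∀ l : ℝ, 0 < l → Om2 (assocFun (assocMatrix ω l))) ∧
        (∀ l : ℝ, 0 < l → HasBeta3 (assocMatrix ω l)) ∧
        MatrixH (assocMatrix ω)) ∧
      -- (f), second part
      (LimInfinite N →
        (Om5 ω ∧ Om5 (assocFun N) ∧ ∀ l : ℝ, 0 < l → Om5 (assocFun (assocMatrix ω l))) ∧
        MatrixBeurlingAnalytic (assocMatrix ω)) := by
  -- (β₃) makes `ω_N` an admissible witness for (i).
  have hWN : IsW (assocFun N) := hN.isW_assocFun hβ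
  refine ⟨?_, fun ω hω heq => ?_⟩
  · tfae_have 1 → 2 := fun ⟨ω, hω, heq⟩ =>
      (hasMg_and_seqEquiv_of_ultraClass_eq hr hs hU hU' hN hω.toIsW0 heq).1
    tfae_have 2 → 3 := fun hmg => (sameClass_funScale_seqScale hWN hN
      (fun l hl => hN.seqEquiv_assocMatrix_assocFun hmg hl) ty r s hr hs U hU hU').1
    tfae_have 3 → 1 := fun h => ⟨assocFun N, hWN, h⟩
    tfae_finish
  obtain ⟨hmg, hequiv⟩ := hasMg_and_seqEquiv_of_ultraClass_eq hr hs hU hU' hN hω.toIsW0 heq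
  have hLC : ∀ l : ℝ, 0 < l → IsLC (assocMatrix ω l) := fun l hl => hω.isLC_assocMatrix hl
  have hWl : ∀ l : ℝ, 0 < l → IsW (assocFun (assocMatrix ω l)) := fun l hl =>
    hω.isW_assocFun_assocMatrix hl
  have hb : ∀ l : ℝ, 0 < l → FunEquiv (assocFun (assocMatrix ω l)) ω := fun l hl =>
    hω.funEquiv_assocFun_assocMatrix hl
  -- `ω` and `ω_N` are compared through the associated function of `Ω^1`, as `Ω^1 ≈ N`.
  have hbN : FunEquiv ω (assocFun N) := (hb 1 one_pos).symm.trans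
    ⟨isBigO_assocFun_of_seqLe (hLC 1 one_pos) hN (hequiv 1 one_pos).2 (hWl 1 one_pos),
      isBigO_assocFun_of_seqLe hN (hLC 1 one_pos) (hequiv 1 one_pos).1 hWN⟩
  have h6N : Om6 (assocFun N) := hN.om6_assocFun hmg
  have hmgl : ∀ l : ℝ, 0 < l → HasMg (assocMatrix ω l) := fun l hl =>
    hmg.of_equiv hN (hLC l hl) (hequiv l hl)
  refine ⟨⟨hWN, hbN.om6 hω.toIsW0 hWN.toIsW0 h6N, h6N, fun l hl =>
      ⟨hWl l hl, (hLC l hl).om6_assocFun (hmgl l hl)⟩⟩, ⟨hbN, hb⟩,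
    ⟨sameClass_funScale_seqScale hWN hN (fun l hl => hN.seqEquiv_assocMatrix_assocFun hmg hl) ty,
      (sameClass_funScale_seqScale hω hN hequiv ty).symm, fun l hl =>
      sameClass_funScale_seqScale hω (hLC l hl) (fun l' hl' =>
        ⟨(hequiv l hl).2.trans (hequiv l' hl').1, (hequiv l' hl').2.trans (hequiv l hl).1⟩) ty⟩,
    hequiv, hmgl, fun h => ?_, fun h => ?_⟩
  · have h2 := hN.om2_assocFun h
    exact ⟨⟨hbN.2.trans h2, h2, fun l hl => ((hb l hl).2.trans hbN.2).trans h2⟩,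
      fun l hl => hβ.of_equiv hN (hLC l hl) hmg (hmgl l hl) (hequiv l hl),
      fun l hl => h.of_seqLe hN.pos (hLC l hl).pos (hequiv l hl).1⟩
  · have h5 := hN.om5_assocFun h
    exact ⟨⟨hbN.2.trans_isLittleO h5, h5, fun l hl =>
      ((hb l hl).2.trans hbN.2).trans_isLittleO h5⟩,
      fun l hl => h.of_seqLe hN.pos (hLC l hl).pos (hequiv l hl).1⟩
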